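/- **Definitions.** A \emph{Reuleaux polygon} of width $1$ with $2N+1$ arcs is a planar convex body $\Omega$ of constant width $1$ with distinct vertices $P_k$, $k\in\mathbb Z/(2N+1)$, and angles $\alpha_k<\beta_k$ such that $P_{k+1}=P_k+(\cos\alpha_k,\sin\alpha_k)$, $P_{k-1}=P_k+(\cos\beta_k,\sin\beta_k)$, and $\partial\Omega$ is the union of the arcs $\Gamma_k=\{P_k+(\cos t,\sin t):\alpha_k\le t\le\beta_k\}$. Let $\Omega$ have inradius $r$, with its incircle $\{|x|=r\}$ centred at the origin; the \emph{outer circle} is $\{|x|=1-r\}$. A \emph{Blaschke deformation} of $\Omega$ with parameter $\varepsilon\in\mathbb R$ acting on $P_k$ replaces $\Omega$ by a Reuleaux polygon $\Omega'$ with $2N+1$ arcs and vertices $P'_j$ such that $P'_k=P_{k-1}+(\cos(\alpha_{k-1}+\varepsilon),\sin(\alpha_{k-1}+\varepsilon))$ and $P'_j=P_j$ for all $j\notin\{k,k+1\}$. It is \emph{admissible} if $\Omega'$ again has inradius $r$ with the incircle centred at the origin. The polygon $\Omega$ is \emph{rigid} if for some $\delta>0$ no admissible Blaschke deformation with $|\varepsilon|<\delta$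 strictly decreases the area. (In particular $\Omega$ is rigid if no admissible Blaschke deformation of any size decreases the area.) An arc $\Gamma_k$ is \emph{extremal} if it is tangent to the incircle and its endpoints $P_{k-1},P_{k+1}$ both lie on the outer circle. Three arcs $\Gamma_{k-1},\Gamma_k,\Gamma_{k+1}$ form a \emph{cluster} if $\Gamma_{k-1}$ and $\Gamma_{k+1}$ are tangent to the incircle, their common point $P_k$ satisfies $r<|P_k|<1-r$, and their other endpoints $P_{k-2}$ and $P_{k+2}$ lie on the outer circle. **Proposition 3.4.** Let $\Omega$ be a rigid Reuleaux polygon of width $1$ and inradius $r$, with incircle centred at the origin. Then the boundary of $\Omega$ is made of a finite number (possibly zero) of clusters and of extremal arcs: the arcs $\Gamma_k$ can be partitioned into pairwise disjoint triples, each forming a cluster, and single arcs, each of which is extremal. -/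

import Mathlib

open Metric MeasureTheory

/-- The unit vector `(cos t, sin t)` of the Euclidean plane, which is identified with `ℂ`. -/
noncomputable def unitVec (t : ℝ) : ℂ := Complex.exp (t * Complex.I)

/-- The width of a (compact, nonempty) plane set in the unit direction `ν`: the distance of the
two lines orthogonal to `ν` that support the set. -/
noncomputable def widthIn (K : Set ℂ) (ν : ℂ) : ℝ :=
  sSup ((fun x : ℂ => inner ℝ ν x) '' K) - sInf ((fun x : ℂ => inner ℝ ν x) '' K)

/-- A plane convex body of constant width `1`. -/
structure IsConstantWidthOne (K : Set ℂ) : Prop where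
  isCompact : IsCompact K
  convex : Convex ℝ K
  interior_nonempty : (interior K).Nonempty
  width_eq : ∀ ν : ℂ, ‖ν‖ = 1 → widthIn K ν = 1

/-- `r` is the inradius of `K`: the largest radius of an open disk contained in `K`. -/
def HasInradius (K : Set ℂ) (r : ℝ) : Prop :=
  IsGreatest {ρ : ℝ | ∃ c : ℂ, ball c ρ ⊆ K} r

/-- `K` has inradius `r`, with an incircle centred at the origin. For a body of constant width `1`
this says that its minimal annulus is the one bounded by the circles of radius `r` and `1 - r`
centred at the origin. -/
def HasCentredIncircle (K : Set ℂ) (r : ℝ) : Prop :=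
  HasInradius K r ∧ ball 0 r ⊆ K

/-- The circular arc of radius `1` and centre `p`, between the angles `a` and `b`. -/
def unitArc (p : ℂ) (a b : ℝ) : Set ℂ := (fun t : ℝ => p + unitVec t) '' Set.Icc a b

/-- A Reuleaux polygon of width `1` with `2 * N + 1` arcs: a convex body of constant width `1`
whose boundary is the union of the arcs `Γ k = {P k + (cos t, sin t) : α k ≤ t ≤ β k}` of radius
`1`, centred at the vertices `P k` of the body and with end points `P (k + 1)` (at `t = α k`) and
`P (k - 1)` (at `t = β k`). The labels are cyclic and every vertex carries one label only. -/
structure ReuleauxPolygon (N : ℕ) where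
  body : Set ℂ
  vertex : ZMod (2 * N + 1) → ℂ
  α : ZMod (2 * N + 1) → ℝ
  β : ZMod (2 * N + 1) → ℝ
  constantWidth : IsConstantWidthOne body
  vertex_injective : Function.Injective vertex
  α_lt_β : ∀ k, α k < β k
  vertex_succ : ∀ k, vertex (k + 1) = vertex k + unitVec (α k)
  vertex_pred : ∀ k, vertex (k - 1) = vertex k + unitVec (β k)
  frontier_eq : frontier body = ⋃ k, unitArc (vertex k) (α k) (β k)

namespace ReuleauxPolygon

variable {N : ℕ}

/-- `Q'` is obtained from `Q` by the Blaschke deformation with parameter `ε` acting on the vertex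
`P k`: this vertex moves by the angle `ε` on the circle that carries the arc `Γ (k - 1)`
(so `α (k - 1)` becomes `α (k - 1) + ε`), the vertex `P (k + 1)` moves accordingly, all other
vertices are kept, and the result is again a Reuleaux polygon. -/
def IsBlaschkeDeformation (Q Q' : ReuleauxPolygon N) (k : ZMod (2 * N + 1)) (ε : ℝ) : Prop :=
  Q'.vertex k = Q.vertex (k - 1) + unitVec (Q.α (k - 1) + ε) ∧
    ∀ j, j ≠ k → j ≠ k + 1 → Q'.vertex j = Q.vertex j

/-- No Blaschke deformation with parameter of absolute value less than `δ` decreases the area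
while keeping the inradius `r` and the incircle. -/
def IsRigidUpTo (Q : ReuleauxPolygon N) (r δ : ℝ) : Prop :=
  ∀ (k : ZMod (2 * N + 1)) (ε : ℝ) (Q' : ReuleauxPolygon N), |ε| < δ →
    Q.IsBlaschkeDeformation Q' k ε → HasCentredIncircle Q'.body r → ¬ volume Q'.body < volume Q.body

/-- A polygon is rigid if no small Blaschke deformation decreases the area while keeping the
inradius `r` and the incircle. This is implied by the absence of such deformations of arbitrary size, that
is, by `Q.IsRigidUpTo r δ` for all `δ`. -/
def IsRigid (Q : ReuleauxPolygon N) (r : ℝ) : Prop :=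
  ∃ δ : ℝ, 0 < δ ∧ Q.IsRigidUpTo r δ

/-- The arc `Γ k` is tangent to the circle of radius `r` centred at the origin: they have a common
point, with the same outer normal. -/
def IsTangentArc (Q : ReuleauxPolygon N) (r : ℝ) (k : ZMod (2 * N + 1)) : Prop :=
  ∃ t ∈ Set.Icc (Q.α k) (Q.β k), Q.vertex k + unitVec t = r * unitVec t

/-- The arc `Γ k` is extremal: it is tangent to the incircle and both end points lie on the outer
circle. -/
def IsExtremalArc (Q : ReuleauxPolygon N) (r : ℝ) (k : ZMod (2 * N + 1)) : Prop :=
  Q.IsTangentArc r k ∧ ‖Q.vertex (k + 1)‖ = 1 - r ∧ ‖Q.vertex (k - 1)‖ = 1 - r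

/-- The arcs `Γ (k - 1)`, `Γ k`, `Γ (k + 1)` form a cluster: the first and the last are tangent to
the incircle, their common end point `P k` lies in the interior of the annulus, and their other
end points `P (k - 2)` and `P (k + 2)` lie on the outer circle. -/
def IsCluster (Q : ReuleauxPolygon N) (r : ℝ) (k : ZMod (2 * N + 1)) : Prop :=
  Q.IsTangentArc r (k - 1) ∧ Q.IsTangentArc r (k + 1) ∧
    r < ‖Q.vertex k‖ ∧ ‖Q.vertex k‖ < 1 - r ∧
    ‖Q.vertex (k - 2)‖ = 1 - r ∧ ‖Q.vertex (k + 2)‖ = 1 - r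

end ReuleauxPolygon

/-- The three labels `k - 1`, `k`, `k + 1`. -/
def labelTriple {n : ℕ} (k : ZMod n) : Finset (ZMod n) := {k - 1, k, k + 1}

/-! The body is the intersection of the unit disks centred at its vertices
(`ReuleauxPolygon.body_eq`), so everything can be read off from the vertices. For ρ > 0, a disk of
radius ρ about c lies in the body exactly when every vertex is within 1 - ρ of c. Hence a centred
incircle of radius r means that all vertices lie in the outer disk and that those on the outer
circle have the origin in their convex hull (`hasCentredIncircle_diskInter`,
`zero_mem_convexHull_outer`). A vertex on the outer circle has an opposite arc tangent to the
incircle (`isTangentArc`), so the claim only concerns which vertices are inner, that is, strictly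
inside the outer circle.

The area is π/2 minus the sum of the determinants of consecutive vertices (`volume_body`). A
Blaschke deformation is the motion of a three-bar linkage with fixed ends P (k - 1), P (k + 2) and
moving joints P k, P (k + 1). The sign of the derivative of the area is the sign of the difference
of the angles of Γ k and Γ (k + 1), and at equality this difference varies strictly monotonically.
So the area strictly decreases for small ε > 0 if Γ (k + 1) is at least as wide as Γ k, and for
small ε < 0 if it is at most as wide (`eventually_crossSum_lt_right`,
`eventually_crossSum_lt_left`).

Two consecutive inner vertices can move both ways, so a rigid polygon has none. Suppose two inner
vertices have only P k between them. Then P k lies in the cone of P (k - 2) and P (k + 2), hence is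
not needed to surround the origin and may move inwards (`zero_mem_convexHull_diff`). Comparing
angles in triangles with a vertex at the origin, Γ k is narrower than one of its two neighbours
(`angle_lt_or_angle_lt`). Moving P k together with that neighbour, in the direction that pulls P k
inwards, is exactly what decreases the area, against rigidity. So inner vertices are at cyclic
distance at least three: the triples around them are disjoint clusters, and every remaining arc is
extremal. -/

/-! ### Plane vectors and unit directions -/

/-- The Euclidean scalar product of two plane vectors. -/
def planeDot (z w : ℂ) : ℝ := z.re * w.re + z.im * w.im

/-- The determinant of two plane vectors. -/
def planeCross (z w : ℂ) : ℝ := z.re * w.im - z.im * w.re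

/-- The intersection of the closed unit disks centred at the points of a family. -/
def diskInter {ι : Type*} (P : ι → ℂ) : Set ℂ := {x | ∀ j, ‖x - P j‖ ≤ 1}

theorem inner_eq_planeDot (z w : ℂ) : inner ℝ z w = planeDot z w := by
  rw [Complex.inner]
  simp [planeDot]
  ring

theorem norm_sq_eq_planeDot (z : ℂ) : ‖z‖ ^ 2 = planeDot z z := by
  rw [← Complex.normSq_eq_norm_sq, Complex.normSq_apply, planeDot]

theorem planeDot_comm (z w : ℂ) : planeDot z w = planeDot w z := by
  simp only [planeDot]; ring

theorem planeDot_add_right (z w v : ℂ) : planeDot z (w + v) = planeDot z w + planeDot z v := by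
  simp only [planeDot, Complex.add_re, Complex.add_im]; ring

theorem planeDot_sub_right (z w v : ℂ) : planeDot z (w - v) = planeDot z w - planeDot z v := by
  simp only [planeDot, Complex.sub_re, Complex.sub_im]; ring

theorem planeDot_neg_left (z w : ℂ) : planeDot (-z) w = -planeDot z w := by
  simp only [planeDot, Complex.neg_re, Complex.neg_im]; ring

theorem planeDot_smul_right (c : ℝ) (z w : ℂ) : planeDot z (c * w) = c * planeDot z w := by
  simp [planeDot]; ring

theorem planeDot_le_norm_mul_norm (z w : ℂ) : planeDot z w ≤ ‖z‖ * ‖w‖ := by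
  rw [← inner_eq_planeDot]; exact real_inner_le_norm z w

@[simp] theorem unitVec_re (t : ℝ) : (unitVec t).re = Real.cos t := by
  simp [unitVec, Complex.exp_ofReal_mul_I_re]

@[simp] theorem unitVec_im (t : ℝ) : (unitVec t).im = Real.sin t := by
  simp [unitVec, Complex.exp_ofReal_mul_I_im]

@[simp] theorem norm_unitVec (t : ℝ) : ‖unitVec t‖ = 1 := by
  simp [unitVec, Complex.norm_exp_ofReal_mul_I]

theorem unitVec_add (s t : ℝ) : unitVec (s + t) = unitVec s * unitVec t := by
  simp only [unitVec, ← Complex.exp_add]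
  congr 1; push_cast; ring

theorem unitVec_add_pi (t : ℝ) : unitVec (t + Real.pi) = -unitVec t := by
  apply Complex.ext <;> simp

theorem unitVec_sub_pi (t : ℝ) : unitVec (t - Real.pi) = -unitVec t := by
  apply Complex.ext <;> simp

theorem exists_unitVec_eq {z : ℂ} (hz : ‖z‖ = 1) : ∃ t, unitVec t = z := by
  refine ⟨z.arg, ?_⟩
  have := Complex.norm_mul_exp_arg_mul_I z
  rw [hz] at this
  simpa [unitVec] using this

theorem planeDot_unitVec (s t : ℝ) : planeDot (unitVec s) (unitVec t) = Real.cos (s - t) := by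
  simp [planeDot, Real.cos_sub]

theorem planeCross_unitVec (s t : ℝ) : planeCross (unitVec s) (unitVec t) = Real.sin (t - s) := by
  simp [planeCross, Real.sin_sub]; ring

theorem planeDot_unitVec_self (s : ℝ) : planeDot (unitVec s) (unitVec s) = 1 := by
  simp [planeDot_unitVec]

/-- A unit vector between two others is a combination of them with nonnegative coefficients. -/
theorem sin_mul_unitVec (a b t : ℝ) : (Real.sin (b - a) : ℂ) * unitVec t =
    Real.sin (b - t) * unitVec a + Real.sin (t - a) * unitVec b := by
  apply Complex.ext
  · simp only [Complex.re_ofReal_mul, Complex.add_re, unitVec_re, Real.sin_sub]; ring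
  · simp only [Complex.im_ofReal_mul, Complex.add_im, unitVec_im, Real.sin_sub]; ring

/-- Equality case of Cauchy–Schwarz. -/
theorem eq_of_planeDot_unitVec_ge {t : ℝ} {z : ℂ} (hz : ‖z‖ ≤ 1)
    (h : 1 ≤ planeDot (unitVec t) z) : z = unitVec t := by
  have h1 := norm_sq_eq_planeDot z
  have h2 : ‖z‖ ^ 2 ≤ 1 := by nlinarith [norm_nonneg z]
  have h3 : ‖z - unitVec t‖ ^ 2 = ‖z‖ ^ 2 + 1 - 2 * planeDot (unitVec t) z := by
    rw [norm_sq_eq_planeDot, norm_sq_eq_planeDot z, ← planeDot_unitVec_self t]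
    simp only [planeDot, Complex.sub_re, Complex.sub_im]; ring
  have h4 : ‖z - unitVec t‖ = 0 := by
    have : ‖z - unitVec t‖ ^ 2 ≤ 0 := by linarith
    nlinarith [norm_nonneg (z - unitVec t)]
  exact sub_eq_zero.mp (norm_eq_zero.mp h4)

/-- The direction t is a nonnegative combination of the directions a and b whose coefficients add up
to at least 1; this is why c has to be nonnegative. Conditions linear in the direction thus pass
from the ends of an arc to the whole arc. -/
theorem planeDot_between {a b t c : ℝ} {w : ℂ} (hab : a < b) (hpi : b < a + Real.pi)
    (ht : t ∈ Set.Icc a b) (hc : 0 ≤ c) (ha : c ≤ planeDot (unitVec a) w)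
    (hb : c ≤ planeDot (unitVec b) w) : c ≤ planeDot (unitVec t) w := by
  have hs : 0 < Real.sin (b - a) := Real.sin_pos_of_pos_of_lt_pi (by linarith) (by linarith)
  have h1 : 0 ≤ Real.sin (b - t) :=
    Real.sin_nonneg_of_nonneg_of_le_pi (by linarith [ht.2]) (by linarith [ht.1])
  have h2 : 0 ≤ Real.sin (t - a) :=
    Real.sin_nonneg_of_nonneg_of_le_pi (by linarith [ht.1]) (by linarith [ht.2])
  have h3 : Real.sin (b - a) ≤ Real.sin (b - t) + Real.sin (t - a) := by
    have : b - a = (b - t) + (t - a) := by ring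
    rw [this, Real.sin_add]
    nlinarith [Real.cos_le_one (b - t), Real.cos_le_one (t - a)]
  have h4 : Real.sin (b - a) * planeDot (unitVec t) w =
      Real.sin (b - t) * planeDot (unitVec a) w + Real.sin (t - a) * planeDot (unitVec b) w := by
    have := congrArg (planeDot w) (sin_mul_unitVec a b t)
    rw [planeDot_add_right, planeDot_smul_right, planeDot_smul_right, planeDot_smul_right] at this
    simpa only [planeDot_comm w] using this
  nlinarith [mul_le_mul_of_nonneg_left ha h1, mul_le_mul_of_nonneg_left hb h2,
    mul_le_mul_of_nonneg_right h3 hc]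

/-! ### Unit stars and the directions of their arcs -/

/-- A closed star of unit segments with vertices at mutual distance at most `1`: the combinatorial
data of a Reuleaux polygon. -/
structure IsUnitStar {N : ℕ} (P : ZMod (2 * N + 1) → ℂ) (α β : ZMod (2 * N + 1) → ℝ) : Prop where
  lt : ∀ k, α k < β k
  lt_add_pi : ∀ k, β k < α k + Real.pi
  succ : ∀ k, P (k + 1) = P k + unitVec (α k)
  pred : ∀ k, P (k - 1) = P k + unitVec (β k)
  norm_sub_le : ∀ i j, ‖P i - P j‖ ≤ 1

namespace IsUnitStar

variable {N : ℕ} {P : ZMod (2 * N + 1) → ℂ} {α β : ZMod (2 * N + 1) → ℝ}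

theorem vertex_mem (h : IsUnitStar P α β) (j : ZMod (2 * N + 1)) : P j ∈ diskInter P :=
  fun i => h.norm_sub_le j i

theorem unitVec_β_succ (h : IsUnitStar P α β) (k : ZMod (2 * N + 1)) :
    unitVec (β (k + 1)) = -unitVec (α k) := by
  have h1 := h.pred (k + 1)
  rw [add_sub_cancel_right, h.succ k] at h1
  linear_combination -h1

/-- Being within distance 1 of P i means, for the point of direction s on the circle about P j, a
lower bound on the scalar product with P i - P j. It holds at both ends of the arc, which are
vertices. -/
theorem arc_mem (h : IsUnitStar P α β) {j : ZMod (2 * N + 1)} {t : ℝ}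
    (ht : t ∈ Set.Icc (α j) (β j)) : P j + unitVec t ∈ diskInter P := by
  intro i
  have key : ∀ s : ℝ, ‖P j + unitVec s - P i‖ ^ 2 =
      1 + ‖P i - P j‖ ^ 2 - 2 * planeDot (unitVec s) (P i - P j) := by
    intro s
    rw [norm_sq_eq_planeDot, norm_sq_eq_planeDot, ← planeDot_unitVec_self s]
    simp only [planeDot, Complex.sub_re, Complex.sub_im, Complex.add_re, Complex.add_im]; ring
  have end_le : ∀ s : ℝ, ‖P j + unitVec s - P i‖ ≤ 1 →
      ‖P i - P j‖ ^ 2 / 2 ≤ planeDot (unitVec s) (P i - P j) := by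
    intro s hs
    have := key s
    nlinarith [norm_nonneg (P j + unitVec s - P i)]
  have h1 := planeDot_between (h.lt j) (h.lt_add_pi j) ht (by positivity)
    (end_le (α j) (by rw [← h.succ]; exact h.norm_sub_le _ _))
    (end_le (β j) (by rw [← h.pred]; exact h.norm_sub_le _ _))
  have h2 := key t
  nlinarith [norm_nonneg (P j + unitVec t - P i)]

/-- The vertex `P j` is a support point in the directions opposite to those of its arc. -/
theorem planeDot_nonneg (h : IsUnitStar P α β) {j : ZMod (2 * N + 1)} {t : ℝ}
    (ht : t ∈ Set.Icc (α j) (β j)) {x : ℂ} (hx : x ∈ diskInter P) :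
    0 ≤ planeDot (unitVec t) (x - P j) := by
  have key : ∀ s : ℝ, ‖x - (P j + unitVec s)‖ ≤ 1 → 0 ≤ planeDot (unitVec s) (x - P j) := by
    intro s hs
    have : ‖x - (P j + unitVec s)‖ ^ 2 =
        1 + ‖x - P j‖ ^ 2 - 2 * planeDot (unitVec s) (x - P j) := by
      rw [norm_sq_eq_planeDot, norm_sq_eq_planeDot, ← planeDot_unitVec_self s]
      simp only [planeDot, Complex.sub_re, Complex.sub_im, Complex.add_re, Complex.add_im]; ring
    nlinarith [norm_nonneg (x - (P j + unitVec s)), sq_nonneg ‖x - P j‖]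
  exact planeDot_between (h.lt j) (h.lt_add_pi j) ht le_rfl
    (key (α j) (by rw [← h.succ]; exact hx _)) (key (β j) (by rw [← h.pred]; exact hx _))

theorem planeDot_le_one (_h : IsUnitStar P α β) (j : ZMod (2 * N + 1)) (t : ℝ)
    {x : ℂ} (hx : x ∈ diskInter P) : planeDot (unitVec t) (x - P j) ≤ 1 := by
  have := planeDot_le_norm_mul_norm (unitVec t) (x - P j)
  rw [norm_unitVec, one_mul] at this
  exact this.trans (hx j)

theorem eq_arc_point (_h : IsUnitStar P α β) {j : ZMod (2 * N + 1)} {t : ℝ}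
    {x : ℂ} (hx : x ∈ diskInter P) (h1 : 1 ≤ planeDot (unitVec t) (x - P j)) :
    x = P j + unitVec t := by
  have := eq_of_planeDot_unitVec_ge (hx j) h1
  linear_combination this

/-- The angle swept by the first `m` arcs after the label `k`. -/
def sweep (α β : ZMod (2 * N + 1) → ℝ) (k : ZMod (2 * N + 1)) (m : ℕ) : ℝ :=
  ∑ i ∈ Finset.range m, (β (k + i) - α (k + i))

theorem sweep_zero (k : ZMod (2 * N + 1)) : sweep α β k 0 = 0 := by simp [sweep]

theorem sweep_succ (k : ZMod (2 * N + 1)) (m : ℕ) :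
    sweep α β k (m + 1) = sweep α β k m + (β (k + m) - α (k + m)) := by
  simp only [sweep, Finset.sum_range_succ]

/-- The last direction of an arc is opposite to the first one of the next arc. Up to the sign (-1) ^
m, the arcs therefore line up into one continuous decreasing sweep of angles. -/
theorem unitVec_sweep (h : IsUnitStar P α β) (k : ZMod (2 * N + 1)) (m : ℕ) (τ : ℝ) :
    (-1) ^ m * unitVec (β k - sweep α β k m - τ) = unitVec (β (k + m) - τ) := by
  induction m generalizing τ with
  | zero => simp [sweep_zero]
  | succ m ih =>
    have h1 := ih (β (k + m) - α (k + m) + τ)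
    have h2 := h.unitVec_β_succ (k + m)
    have e1 : β k - sweep α β k (m + 1) - τ =
      β k - sweep α β k m - (β (k + m) - α (k + m) + τ) := by rw [sweep_succ]; ring
    have e2 : β (k + m) - (β (k + m) - α (k + m) + τ) = α (k + m) + -τ := by ring
    rw [e2, unitVec_add] at h1
    rw [e1, pow_succ, mul_comm _ (-1 : ℂ), mul_assoc, h1, sub_eq_add_neg (β _), unitVec_add]
    push_cast
    rw [← add_assoc, h2]; ring

theorem sweep_mono (h : IsUnitStar P α β) (k : ZMod (2 * N + 1)) : StrictMono (sweep α β k) := by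
  apply strictMono_nat_of_lt_succ
  intro m
  rw [sweep_succ]
  linarith [h.lt (k + m)]

/-- After a full turn through an odd number of labels the direction comes back with the opposite
sign, so the swept angle is an odd multiple of π; it is positive. -/
theorem exists_sweep_eq (h : IsUnitStar P α β) (k : ZMod (2 * N + 1)) :
    ∃ z : ℕ, sweep α β k (2 * N + 1) = Real.pi + z * (2 * Real.pi) := by
  have h1 := h.unitVec_sweep k (2 * N + 1) (β k - sweep α β k (2 * N + 1))
  have h2 : ((2 * N + 1 : ℕ) : ZMod (2 * N + 1)) = 0 := ZMod.natCast_self _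
  rw [h2, add_zero, sub_self, Odd.neg_one_pow ⟨N, rfl⟩] at h1
  have e : β k - (β k - sweep α β k (2 * N + 1)) = sweep α β k (2 * N + 1) := by ring
  rw [e] at h1
  have h3 : Real.cos (sweep α β k (2 * N + 1) - Real.pi) = 1 := by
    rw [Real.cos_sub_pi, ← unitVec_re, ← h1]
    simp
  obtain ⟨z, hz⟩ := (Real.cos_eq_one_iff _).mp h3
  have hpos : 0 < sweep α β k (2 * N + 1) := by
    have := h.sweep_mono k (Nat.succ_pos (2 * N)); rwa [sweep_zero] at this
  have hz0 : 0 ≤ z := by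
    by_contra hneg
    have : (z : ℝ) ≤ -1 := by exact_mod_cast (by omega : z ≤ -1)
    nlinarith [Real.pi_pos]
  lift z to ℕ using hz0
  exact ⟨z, by push_cast at hz; linarith⟩

theorem exists_sweep_interval (k : ZMod (2 * N + 1)) {τ : ℝ} {n : ℕ}
    (h0 : 0 ≤ τ) (h1 : τ < sweep α β k n) :
    ∃ m < n, sweep α β k m ≤ τ ∧ τ < sweep α β k (m + 1) := by
  induction n with
  | zero => rw [sweep_zero] at h1; linarith
  | succ n ih =>
    by_cases hn : τ < sweep α β k n
    · obtain ⟨m, hm, hm'⟩ := ih hn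
      exact ⟨m, by omega, hm'⟩
    · exact ⟨n, by omega, not_lt.mp hn, h1⟩

theorem exists_label_of_sweep (h : IsUnitStar P α β) (k : ZMod (2 * N + 1)) {τ : ℝ} {n : ℕ}
    (h0 : 0 ≤ τ) (h1 : τ < sweep α β k n) :
    ∃ m < n, sweep α β k m ≤ τ ∧ τ < sweep α β k (m + 1) ∧
      ∃ t ∈ Set.Icc (α (k + m)) (β (k + m)),
      unitVec (β k - τ) = unitVec t ∨ unitVec (β k - τ) = -unitVec t := by
  obtain ⟨m, hm, h2, h3⟩ := exists_sweep_interval k h0 h1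
  refine ⟨m, hm, h2, h3, β (k + m) - (τ - sweep α β k m), ⟨?_, by linarith⟩, ?_⟩
  · rw [sweep_succ] at h3; linarith
  · rw [← h.unitVec_sweep k m]
    have : β k - sweep α β k m - (τ - sweep α β k m) = β k - τ := by ring
    rw [this]
    rcases neg_one_pow_eq_or ℂ m with e | e <;> simp [e]

theorem unitVec_sub_int_mul_pi (s : ℝ) (z : ℤ) :
    unitVec (s - z * Real.pi) = unitVec s ∨ unitVec (s - z * Real.pi) = -unitVec s := by
  rcases Int.even_or_odd z with ⟨m, hm⟩ | ⟨m, hm⟩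
  · left
    apply Complex.ext
    · rw [unitVec_re, unitVec_re, hm, ← Real.cos_sub_int_mul_two_pi s m]; push_cast; ring_nf
    · rw [unitVec_im, unitVec_im, hm, ← Real.sin_sub_int_mul_two_pi s m]; push_cast; ring_nf
  · right
    have : s - z * Real.pi = (s - Real.pi) - m * (2 * Real.pi) := by rw [hm]; push_cast; ring
    apply Complex.ext
    · rw [this, unitVec_re, Real.cos_sub_int_mul_two_pi]; simp
    · rw [this, unitVec_im, Real.sin_sub_int_mul_two_pi]; simp

/-- Up to sign, every direction belongs to some arc. -/
theorem exists_arc_direction (h : IsUnitStar P α β) (s : ℝ) :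
    ∃ j, ∃ t ∈ Set.Icc (α j) (β j), unitVec s = unitVec t ∨ unitVec s = -unitVec t := by
  obtain ⟨z, hz⟩ := h.exists_sweep_eq 0
  -- The sign is free, so the angle matters only modulo π; its representative in [0, π) is covered
  -- because the full sweep is at least π.
  set τ := toIcoMod Real.pi_pos 0 (β 0 - s) with hτ
  have hmem := toIcoMod_mem_Ico' Real.pi_pos (β 0 - s)
  rw [← hτ] at hmem
  have hzpi : (0 : ℝ) ≤ z * (2 * Real.pi) := by positivity
  obtain ⟨m, -, -, -, t, ht, hs⟩ := h.exists_label_of_sweep 0 hmem.1 (n := 2 * N + 1)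
    (by linarith [hmem.2])
  refine ⟨_, t, ht, ?_⟩
  have e : β 0 - τ = s - (-toIcoDiv Real.pi_pos 0 (β 0 - s) : ℤ) * Real.pi := by
    have := toIcoMod_add_toIcoDiv_zsmul Real.pi_pos 0 (β 0 - s)
    rw [zsmul_eq_mul] at this
    push_cast
    linarith
  rw [e] at hs
  rcases unitVec_sub_int_mul_pi s (-toIcoDiv Real.pi_pos 0 (β 0 - s)) with h1 | h1
  · rwa [h1] at hs
  · rw [h1] at hs
    rcases hs with h2 | h2
    · right; rw [← h2, neg_neg]
    · left; exact neg_injective h2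

end IsUnitStar

/-! ### Disk intersections of unit stars: constant width and boundary -/

namespace IsUnitStar

variable {N : ℕ} {P : ZMod (2 * N + 1) → ℂ} {α β : ZMod (2 * N + 1) → ℝ}

theorem _root_.diskInter_eq_iInter {ι : Type*} (P : ι → ℂ) :
    diskInter P = ⋂ j, closedBall (P j) 1 := by
  ext x; simp [diskInter, dist_eq_norm]

theorem _root_.convex_diskInter {ι : Type*} (P : ι → ℂ) : Convex ℝ (diskInter P) := by
  rw [diskInter_eq_iInter]; exact convex_iInter fun j => convex_closedBall _ _

theorem _root_.isCompact_diskInter {ι : Type*} [Nonempty ι] (P : ι → ℂ) :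
    IsCompact (diskInter P) := by
  rw [diskInter_eq_iInter]
  obtain ⟨i⟩ := ‹Nonempty ι›
  exact (isCompact_closedBall (P i) 1).of_isClosed_subset
    (isClosed_iInter fun j => isClosed_closedBall) (Set.iInter_subset _ i)

theorem planeDot_mem_Icc (h : IsUnitStar P α β) {j : ZMod (2 * N + 1)} {t : ℝ}
    (ht : t ∈ Set.Icc (α j) (β j)) {x : ℂ} (hx : x ∈ diskInter P) :
    planeDot (unitVec t) x ∈
      Set.Icc (planeDot (unitVec t) (P j)) (planeDot (unitVec t) (P j) + 1) := by
  have h1 := h.planeDot_nonneg ht hx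
  have h2 := h.planeDot_le_one j t hx
  rw [planeDot_sub_right] at h1 h2
  exact ⟨by linarith, by linarith⟩

theorem _root_.widthIn_neg (K : Set ℂ) (ν : ℂ) : widthIn K (-ν) = widthIn K ν := by
  have : (fun x : ℂ => inner ℝ (-ν) x) '' K = -((fun x : ℂ => inner ℝ ν x) '' K) := by
    rw [← Set.image_neg_eq_neg, Set.image_image]; simp
  rw [widthIn, widthIn, this, Real.sInf_def, Real.sInf_def, neg_neg]
  ring

/-- In a direction of Γ j the set lies in a strip of width 1 that is touched on one side by P j and
on the other by a point of Γ j; up to sign there are no other directions. -/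
theorem widthIn_eq_one (h : IsUnitStar P α β) {ν : ℂ} (hν : ‖ν‖ = 1) :
    widthIn (diskInter P) ν = 1 := by
  obtain ⟨s, rfl⟩ := exists_unitVec_eq hν
  obtain ⟨j, t, ht, hst⟩ := h.exists_arc_direction s
  have main : widthIn (diskInter P) (unitVec t) = 1 := by
    have h1 : IsGreatest ((fun x : ℂ => inner ℝ (unitVec t) x) '' diskInter P)
        (planeDot (unitVec t) (P j) + 1) := by
      refine ⟨⟨_, h.arc_mem ht, ?_⟩, ?_⟩
      · simp only [inner_eq_planeDot, planeDot_add_right, planeDot_unitVec_self]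
      · rintro _ ⟨x, hx, rfl⟩
        simpa only [inner_eq_planeDot] using (h.planeDot_mem_Icc ht hx).2
    have h2 : IsLeast ((fun x : ℂ => inner ℝ (unitVec t) x) '' diskInter P)
        (planeDot (unitVec t) (P j)) := by
      refine ⟨⟨_, h.vertex_mem j, ?_⟩, ?_⟩
      · simp only [inner_eq_planeDot]
      · rintro _ ⟨x, hx, rfl⟩
        simpa only [inner_eq_planeDot] using (h.planeDot_mem_Icc ht hx).1
    rw [widthIn, h1.csSup_eq, h2.csInf_eq]; ring
  rcases hst with e | e
  · rw [e, main]
  · rw [e, widthIn_neg, main]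

theorem isConstantWidthOne (h : IsUnitStar P α β) (hinter : (interior (diskInter P)).Nonempty) :
    IsConstantWidthOne (diskInter P) :=
  ⟨isCompact_diskInter P, convex_diskInter P, hinter, fun _ hν => h.widthIn_eq_one hν⟩

theorem arc_subset_frontier (h : IsUnitStar P α β) (j : ZMod (2 * N + 1)) :
    unitArc (P j) (α j) (β j) ⊆ frontier (diskInter P) := by
  rintro _ ⟨t, ht, rfl⟩
  refine ⟨subset_closure (h.arc_mem ht), fun hinter => ?_⟩
  have h1 : P j + unitVec t ∈ interior (closedBall (P j) 1) := by
    refine interior_mono ?_ hinter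
    rw [diskInter_eq_iInter]; exact Set.iInter_subset _ j
  rw [interior_closedBall _ one_ne_zero, mem_ball, dist_eq_norm] at h1
  simp at h1

theorem frontier_diskInter (h : IsUnitStar P α β) :
    frontier (diskInter P) = ⋃ k, unitArc (P k) (α k) (β k) := by
  apply Set.Subset.antisymm _ (Set.iUnion_subset h.arc_subset_frontier)
  intro x hx
  have hxK : x ∈ diskInter P := (isCompact_diskInter P).isClosed.frontier_subset hx
  obtain ⟨j, hj⟩ : ∃ j, ‖x - P j‖ = 1 := by
    by_contra hcon
    push Not at hcon
    apply hx.2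
    rw [mem_interior]
    refine ⟨⋂ j, ball (P j) 1, ?_, isOpen_iInter_of_finite fun j => isOpen_ball, ?_⟩
    · rw [diskInter_eq_iInter]; exact Set.iInter_mono fun j => ball_subset_closedBall
    · simp only [Set.mem_iInter, mem_ball, dist_eq_norm]
      exact fun j => lt_of_le_of_ne (hxK j) (hcon j)
  obtain ⟨s, hs⟩ := exists_unitVec_eq hj
  obtain ⟨i, t, ht, hst⟩ := h.exists_arc_direction s
  rw [Set.mem_iUnion]
  have hx' : x = P j + unitVec s := by rw [hs]; ring
  have hd := planeDot_unitVec_self t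
  have hP := (h.planeDot_mem_Icc ht (h.vertex_mem j)).1
  have hX := (h.planeDot_mem_Icc ht hxK).1
  -- With the plus sign, x is extreme in direction t and so is the point of Γ i in this direction.
  -- With the minus sign, P j is that point, which forces x = P i, an end of Γ (i - 1).
  rcases hst with e | e
  · refine ⟨i, t, ht, (h.eq_arc_point hxK ?_).symm⟩
    rw [planeDot_sub_right, hx', planeDot_add_right, e, hd]; linarith
  · have h1 : P j = P i + unitVec t := by
      apply h.eq_arc_point (h.vertex_mem j)
      have : P j = x + unitVec t := by rw [hx', e]; ring
      rw [this, planeDot_sub_right, planeDot_add_right, hd]; linarith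
    have h2 : x = P i := by rw [hx', h1, e]; ring
    refine ⟨i - 1, α (i - 1), ⟨le_rfl, (h.lt _).le⟩, ?_⟩
    have := h.succ (i - 1)
    rw [sub_add_cancel] at this
    rw [h2]; exact this.symm

/-- At a relatively interior point of an arc the outer normal is unique. -/
theorem normal_unique (h : IsUnitStar P α β) {j : ZMod (2 * N + 1)} {s t : ℝ}
    (ht : t ∈ Set.Ioo (α j) (β j))
    (hs : ∀ x ∈ diskInter P, planeDot (unitVec s) x ≤ planeDot (unitVec s) (P j + unitVec t)) :
    unitVec s = unitVec t := by
  have hmax : IsLocalMax (fun τ => Real.cos (s - τ)) t := by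
    filter_upwards [Ioo_mem_nhds ht.1 ht.2] with τ hτ
    have := hs _ (h.arc_mem (Set.Ioo_subset_Icc_self hτ))
    rw [planeDot_add_right, planeDot_add_right, planeDot_unitVec, planeDot_unitVec] at this
    linarith
  have hder : HasDerivAt (fun τ => Real.cos (s - τ)) (Real.sin (s - t)) t := by
    have := ((hasDerivAt_id t).const_sub s).cos
    simpa using this
  have h0 : Real.sin (s - t) = 0 := hmax.hasDerivAt_eq_zero hder
  have h1 := hs _ (h.vertex_mem j)
  rw [planeDot_add_right, planeDot_unitVec] at h1
  have h2 : Real.cos (s - t) = 1 := by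
    have := Real.sin_sq_add_cos_sq (s - t)
    rw [h0] at this
    nlinarith
  have e : s = (s - t) + t := by ring
  have h3 : unitVec (s - t) = 1 := by apply Complex.ext <;> simp [h0, h2]
  rw [e, unitVec_add, h3, one_mul]

theorem unitVec_α_ne_β (h : IsUnitStar P α β) (j : ZMod (2 * N + 1)) :
    unitVec (α j) ≠ unitVec (β j) := by
  intro e
  have h1 := planeCross_unitVec (α j) (β j)
  rw [← e] at h1
  have h2 : 0 < Real.sin (β j - α j) :=
    Real.sin_pos_of_pos_of_lt_pi (by linarith [h.lt j]) (by linarith [h.lt_add_pi j])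
  rw [← h1] at h2
  simp [planeCross, mul_comm] at h2

/-- A vertex has many outer normals, the opposites of the directions of its arc, whereas a
relatively interior point of an arc has only one. -/
theorem arc_point_ne_vertex (h : IsUnitStar P α β) {i : ZMod (2 * N + 1)} {t : ℝ}
    (ht : t ∈ Set.Ioo (α i) (β i)) (j : ZMod (2 * N + 1)) : P i + unitVec t ≠ P j := by
  intro e
  have key : ∀ s ∈ Set.Icc (α j) (β j), -unitVec s = unitVec t := by
    intro s hs
    rw [← unitVec_add_pi]
    apply h.normal_unique ht
    intro x hx
    rw [e, unitVec_add_pi, planeDot_neg_left, planeDot_neg_left]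
    linarith [(h.planeDot_mem_Icc hs hx).1]
  apply h.unitVec_α_ne_β j
  have h1 := key (α j) ⟨le_rfl, (h.lt j).le⟩
  have h2 := key (β j) ⟨(h.lt j).le, le_rfl⟩
  exact neg_injective (h1.trans h2.symm)

/-- The arcs of a star have different directions, even up to sign. -/
theorem label_eq_of_direction (h : IsUnitStar P α β) (hP : Function.Injective P)
    {i j : ZMod (2 * N + 1)} {s t : ℝ} (ht : t ∈ Set.Ioo (α i) (β i))
    (hs : s ∈ Set.Icc (α j) (β j)) (e : unitVec s = unitVec t ∨ unitVec s = -unitVec t) :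
    i = j := by
  have hI := (h.planeDot_mem_Icc (Set.Ioo_subset_Icc_self ht) (h.vertex_mem j)).1
  rcases e with e | e
  · have h2 : P j + unitVec s = P i + unitVec t := by
      apply h.eq_arc_point (h.arc_mem hs)
      rw [planeDot_sub_right, planeDot_add_right, e, planeDot_unitVec_self]
      linarith
    rw [e] at h2
    exact hP (add_right_cancel h2).symm
  · exfalso
    apply h.arc_point_ne_vertex ht j
    symm
    apply h.eq_arc_point (h.vertex_mem j)
    have h1 := (h.planeDot_mem_Icc hs (h.arc_mem (Set.Ioo_subset_Icc_self ht))).1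
    rw [e, planeDot_neg_left, planeDot_neg_left, planeDot_add_right, planeDot_unitVec_self] at h1
    rw [planeDot_sub_right]; linarith

/-- A sweep longer than π would come back, up to sign, to a direction of the first arc while still
within one turn of the labels. Distinct vertices exclude this. -/
theorem sweep_eq_pi (h : IsUnitStar P α β) (hP : Function.Injective P) (k : ZMod (2 * N + 1)) :
    sweep α β k (2 * N + 1) = Real.pi := by
  obtain ⟨z, hz⟩ := h.exists_sweep_eq k
  rcases Nat.eq_zero_or_pos z with rfl | hz0
  · simpa using hz
  exfalso
  have hz1 : (1 : ℝ) ≤ z := by exact_mod_cast hz0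
  -- Half the angle of the arc, so that the test direction is its midpoint, in the open arc as
  -- `label_eq_of_direction` requires.
  set η := (β k - α k) / 2 with hη
  have hk := h.lt k
  have hk' := h.lt_add_pi k
  obtain ⟨m, hm, -, h3, t, ht, e⟩ := h.exists_label_of_sweep k (τ := η + Real.pi) (n := 2 * N + 1)
    (by have := Real.pi_pos; linarith) (by nlinarith [Real.pi_pos])
  have hmem : β k - η ∈ Set.Ioo (α k) (β k) := ⟨by linarith, by linarith⟩
  have e' : unitVec (β k - (η + Real.pi)) = -unitVec (β k - η) := by
    rw [← unitVec_sub_pi]; congr 1; ring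
  rw [e'] at e
  have h4 : k = k + m := by
    apply h.label_eq_of_direction hP hmem ht
    rcases e with e | e
    · exact Or.inr e.symm
    · exact Or.inl (neg_injective e).symm
  have h5 : (m : ZMod (2 * N + 1)) = 0 := by simpa using h4.symm
  rw [ZMod.natCast_eq_zero_iff] at h5
  have h6 : m = 0 := Nat.eq_zero_of_dvd_of_lt h5 hm
  rw [h6, zero_add, ← zero_add 1, sweep_succ, sweep_zero] at h3
  simp at h3
  linarith

theorem sum_angles (h : IsUnitStar P α β) (hP : Function.Injective P) :
    ∑ j, (β j - α j) = Real.pi := by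
  rw [← h.sweep_eq_pi hP 0, sweep, ← Fin.sum_univ_eq_sum_range
    (fun i : ℕ => β (0 + (i : ZMod (2 * N + 1))) - α (0 + (i : ZMod (2 * N + 1))))]
  refine Finset.sum_congr rfl fun j _ => ?_
  rw [zero_add]
  have : ((ZMod.val j : ℕ) : ZMod (2 * N + 1)) = j := ZMod.natCast_zmod_val j
  change _ = β ((ZMod.val j : ℕ) : ZMod (2 * N + 1)) - α ((ZMod.val j : ℕ) : ZMod (2 * N + 1))
  rw [this]

/-- A unit segment between two vertices has the direction of some arc up to sign, so it joins the
centre of that arc to one of its points; the point is a vertex, hence an end of the arc. Strict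
inequality for the other pairs is what survives small perturbations. -/
theorem adjacent_of_norm_sub_eq_one (h : IsUnitStar P α β) (hP : Function.Injective P)
    {i j : ZMod (2 * N + 1)} (hij : ‖P i - P j‖ = 1) : i = j + 1 ∨ j = i + 1 := by
  have key : ∀ {i j m : ZMod (2 * N + 1)} {t : ℝ}, t ∈ Set.Icc (α m) (β m) →
      P i - P j = unitVec t → i = j + 1 ∨ j = i + 1 := by
    intro i j m t ht e
    have h1 : P i = P m + unitVec t := by
      apply h.eq_arc_point (h.vertex_mem i)
      have := (h.planeDot_mem_Icc ht (h.vertex_mem j)).1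
      have e' : P i = P j + unitVec t := by rw [← e]; ring
      rw [e', planeDot_sub_right, planeDot_add_right, planeDot_unitVec_self]; linarith
    have h2 : m = j := by
      apply hP; linear_combination e - h1
    subst h2
    rcases eq_or_lt_of_le ht.1 with h3 | h3
    · left; apply hP; rw [h1, ← h3, h.succ]
    rcases eq_or_lt_of_le ht.2 with h4 | h4
    · right
      have : i = m - 1 := by apply hP; rw [h1, h4, h.pred]
      rw [this]; ring
    · exact absurd h1.symm (h.arc_point_ne_vertex ⟨h3, h4⟩ i)
  obtain ⟨s, hs⟩ := exists_unitVec_eq hij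
  obtain ⟨m, t, ht, e | e⟩ := h.exists_arc_direction s
  · exact key ht (hs.symm.trans e)
  · refine (key (i := j) (j := i) ht ?_).symm
    rw [← neg_sub, ← hs, e, neg_neg]

end IsUnitStar

/-! ### Reuleaux polygons as disk intersections -/

theorem IsConstantWidthOne.norm_sub_le {K : Set ℂ} (hK : IsConstantWidthOne K) {x y : ℂ}
    (hx : x ∈ K) (hy : y ∈ K) : ‖x - y‖ ≤ 1 := by
  rcases eq_or_ne x y with rfl | hxy
  · simp
  have hpos : 0 < ‖x - y‖ := norm_pos_iff.mpr (sub_ne_zero.mpr hxy)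
  set ν : ℂ := (‖x - y‖⁻¹ : ℝ) * (x - y) with hν
  have hν1 : ‖ν‖ = 1 := by
    rw [hν, norm_mul, Complex.norm_real, norm_inv, norm_norm, inv_mul_cancel₀ hpos.ne']
  have hw := hK.width_eq ν hν1
  have hcomp : IsCompact ((fun z : ℂ => inner ℝ ν z) '' K) :=
    hK.isCompact.image (by fun_prop)
  have h1 : inner ℝ ν x ≤ sSup ((fun z : ℂ => inner ℝ ν z) '' K) :=
    le_csSup hcomp.bddAbove ⟨x, hx, rfl⟩
  have h2 : sInf ((fun z : ℂ => inner ℝ ν z) '' K) ≤ inner ℝ ν y :=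
    csInf_le hcomp.bddBelow ⟨y, hy, rfl⟩
  have h3 : inner ℝ ν x - inner ℝ ν y = ‖x - y‖ := by
    rw [← inner_sub_right, inner_eq_planeDot, planeDot_comm, hν, planeDot_smul_right,
      ← norm_sq_eq_planeDot, sq, ← mul_assoc, inv_mul_cancel₀ hpos.ne', one_mul]
  rw [widthIn] at hw
  linarith

/-- A convex set that contains a closed one with interior points, and has the same frontier, is equal
to it. -/
theorem eq_of_frontier_eq {K L : Set ℂ} (hK : IsClosed K) (hinter : (interior K).Nonempty)
    (hL : Convex ℝ L) (hKL : K ⊆ L) (hf : frontier L = frontier K) : K = L := by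
  refine hKL.antisymm fun x hx => ?_
  by_contra hxK
  obtain ⟨p, hp⟩ := hinter
  have hcon : IsPreconnected (segment ℝ p x) := (convex_segment p x).isPreconnected
  obtain ⟨z, hz, hzf⟩ : (segment ℝ p x ∩ frontier K).Nonempty :=
    by
    by_contra hne
    rw [Set.not_nonempty_iff_eq_empty] at hne
    obtain ⟨y, -, hy1, hy2⟩ := hcon (interior K) Kᶜ isOpen_interior hK.isOpen_compl
      (fun y hy => by
        by_cases hyK : y ∈ K
        · left
          by_contra hyi
          have : y ∈ segment ℝ p x ∩ frontier K := ⟨hy, subset_closure hyK, hyi⟩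
          simp [hne] at this
        · exact Or.inr hyK)
      ⟨p, left_mem_segment ℝ p x, hp⟩ ⟨x, right_mem_segment ℝ p x, hxK⟩
    exact hy2 (interior_subset hy1)
  have hzK : z ∈ K := hK.frontier_subset hzf
  have hzx : z ≠ x := fun e => hxK (e ▸ hzK)
  have hzp : z ≠ p := fun e => hzf.2 (e ▸ hp)
  have hzo : z ∈ openSegment ℝ p x := mem_openSegment_of_ne_left_right hzp.symm hzx.symm hz
  have : z ∈ interior L :=
    hL.openSegment_interior_self_subset_interior (interior_mono hKL hp) hx hzo
  rw [← hf] at hzf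
  exact hzf.2 this

namespace ReuleauxPolygon

variable {N : ℕ}

theorem arc_mem_body (Q : ReuleauxPolygon N) {k : ZMod (2 * N + 1)} {t : ℝ}
    (ht : t ∈ Set.Icc (Q.α k) (Q.β k)) : Q.vertex k + unitVec t ∈ Q.body := by
  apply Q.constantWidth.isCompact.isClosed.frontier_subset
  rw [Q.frontier_eq]
  exact Set.mem_iUnion.mpr ⟨k, t, ht, rfl⟩

theorem vertex_mem_body (Q : ReuleauxPolygon N) (k : ZMod (2 * N + 1)) : Q.vertex k ∈ Q.body := by
  have h := Q.vertex_succ (k - 1)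
  rw [sub_add_cancel] at h
  rw [h]
  exact Q.arc_mem_body ⟨le_rfl, (Q.α_lt_β _).le⟩

theorem isUnitStar (Q : ReuleauxPolygon N) : IsUnitStar Q.vertex Q.α Q.β where
  lt := Q.α_lt_β
  lt_add_pi k := by
    -- An arc of at least a half turn would contain two antipodal points of a unit circle, at
    -- distance 2, while the diameter is 1.
    by_contra hcon
    push Not at hcon
    have h1 := Q.arc_mem_body (k := k) (t := Q.α k) ⟨le_rfl, (Q.α_lt_β _).le⟩
    have h2 := Q.arc_mem_body (k := k) (t := Q.α k + Real.pi)
      ⟨by linarith [Real.pi_pos], hcon⟩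
    have h3 := Q.constantWidth.norm_sub_le h1 h2
    rw [unitVec_add_pi] at h3
    have e : Q.vertex k + unitVec (Q.α k) - (Q.vertex k + -unitVec (Q.α k)) =
      2 * unitVec (Q.α k) := by ring
    rw [e, norm_mul, norm_unitVec] at h3
    norm_num at h3
  succ := Q.vertex_succ
  pred := Q.vertex_pred
  norm_sub_le i j := Q.constantWidth.norm_sub_le (Q.vertex_mem_body i) (Q.vertex_mem_body j)

theorem body_eq (Q : ReuleauxPolygon N) : Q.body = diskInter Q.vertex :=
  eq_of_frontier_eq Q.constantWidth.isCompact.isClosed Q.constantWidth.interior_nonempty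
    (convex_diskInter _)
    (fun _ hx j => Q.constantWidth.norm_sub_le hx (Q.vertex_mem_body j))
    (by rw [Q.isUnitStar.frontier_diskInter, Q.frontier_eq])

theorem norm_vertex_sub_lt_one (Q : ReuleauxPolygon N) {i j : ZMod (2 * N + 1)} (h1 : i ≠ j + 1)
    (h2 : j ≠ i + 1) : ‖Q.vertex i - Q.vertex j‖ < 1 :=
  lt_of_le_of_ne (Q.isUnitStar.norm_sub_le i j) fun e =>
    (Q.isUnitStar.adjacent_of_norm_sub_eq_one Q.vertex_injective e).elim h1 h2

end ReuleauxPolygon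

/-! ### The incircle in terms of the vertices -/

theorem ball_subset_diskInter {ι : Type*} {P : ι → ℂ} {c : ℂ} {r : ℝ}
    (h : ∀ j, ‖P j - c‖ ≤ 1 - r) : ball c r ⊆ diskInter P := by
  intro x hx j
  rw [mem_ball, dist_eq_norm] at hx
  calc ‖x - P j‖ = ‖(x - c) - (P j - c)‖ := by congr 1; ring
    _ ≤ ‖x - c‖ + ‖P j - c‖ := norm_sub_le _ _
    _ ≤ 1 := by linarith [h j]

/-- The point of the closed disk farthest from x, on the far side of c, is at distance r + ‖x - c‖
from x. This is the converse of `ball_subset_diskInter`. -/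
theorem norm_add_le_one_of_ball_subset {K : Set ℂ} (hK : IsClosed K)
    {r : ℝ} (hr : 0 < r) {c x : ℂ} (hball : ball c r ⊆ K) (hx : ∀ y ∈ K, ‖y - x‖ ≤ 1) :
    ‖x - c‖ ≤ 1 - r := by
  obtain ⟨u, hu, hux⟩ : ∃ u : ℂ, ‖u‖ = 1 ∧ x - c = ‖x - c‖ * u := by
    rcases eq_or_ne (x - c) 0 with e | e
    · exact ⟨1, by simp, by simp [e]⟩
    · have : (‖x - c‖ : ℂ) ≠ 0 := by exact_mod_cast norm_ne_zero_iff.mpr e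
      exact ⟨(x - c) / ‖x - c‖, by simp [norm_ne_zero_iff.mpr e], by field_simp⟩
  have hcl : closedBall c r ⊆ K := by
    rw [← closure_ball c hr.ne']; exact hK.closure_subset_iff.mpr hball
  have hmem : c - r * u ∈ K := by
    apply hcl
    simp [hu, abs_of_pos hr]
  have h1 := hx _ hmem
  have e : c - r * u - x = ((-(r + ‖x - c‖) : ℝ) : ℂ) * u := by
    push_cast
    linear_combination -hux
  rw [e, norm_mul, hu, mul_one, Complex.norm_real, Real.norm_eq_abs, abs_neg,
    abs_of_nonneg (by positivity)] at h1
  linarith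

theorem exists_planeDot_nonpos {S : Set ℂ} (h0 : (0 : ℂ) ∈ convexHull ℝ S) (c : ℂ) :
    ∃ x ∈ S, planeDot c x ≤ 0 := by
  by_contra hcon
  push Not at hcon
  have hconv : Convex ℝ {x : ℂ | 0 < planeDot c x} := by
    intro x hx y hy a b ha hb hab
    simp only [Set.mem_ofPred_eq, planeDot, Complex.add_re, Complex.add_im, Complex.smul_re,
      Complex.smul_im, smul_eq_mul] at hx hy ⊢
    rcases eq_or_lt_of_le ha with e | e
    · subst e; simp at hab; subst hab; linarith
    · nlinarith [mul_pos e hx, mul_nonneg hb hy.le]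
  have : (0 : ℂ) ∈ {x : ℂ | 0 < planeDot c x} :=
    convexHull_min (s := S) (fun x hx => hcon x hx) hconv h0
  simp [planeDot] at this

/-- If the origin is in the convex hull of points on the circle of radius `R`, then no smaller disk
contains these points. -/
theorem le_of_zero_mem_convexHull {S : Set ℂ} {R ρ : ℝ} {c : ℂ} (hR : 0 ≤ R) (hρ : 0 ≤ ρ)
    (h0 : (0 : ℂ) ∈ convexHull ℝ S) (hS : ∀ x ∈ S, ‖x‖ = R) (hc : ∀ x ∈ S, ‖x - c‖ ≤ ρ) :
    R ≤ ρ := by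
  obtain ⟨x, hx, hd⟩ := exists_planeDot_nonpos h0 c
  have h2 : ‖x - c‖ ^ 2 = ‖x‖ ^ 2 + ‖c‖ ^ 2 - 2 * planeDot c x := by
    rw [norm_sq_eq_planeDot, norm_sq_eq_planeDot, norm_sq_eq_planeDot]
    simp only [planeDot, Complex.sub_re, Complex.sub_im]; ring
  have h3 := hc x hx
  rw [hS x hx] at h2
  have h4 : R ^ 2 ≤ ρ ^ 2 := by nlinarith [norm_nonneg (x - c), sq_nonneg ‖c‖]
  exact (sq_le_sq₀ hR hρ).mp h4

/-- The criterion of admissibility: points of the outer circle that surround the origin fit into no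
smaller disk, hence no larger disk fits into the body. Any such set S of vertices will do, in
particular one that a deformation leaves fixed. -/
theorem hasCentredIncircle_diskInter {ι : Type*} [Nonempty ι] {P : ι → ℂ} {r : ℝ} (hr : 0 < r)
    (hP : ∀ j, ‖P j‖ ≤ 1 - r) {S : Set ℂ} (hS : ∀ x ∈ S, (∃ j, P j = x) ∧ ‖x‖ = 1 - r)
    (h0 : (0 : ℂ) ∈ convexHull ℝ S) : HasCentredIncircle (diskInter P) r := by
  have hball : ball 0 r ⊆ diskInter P := ball_subset_diskInter fun j => by simpa using hP j
  refine ⟨⟨⟨0, hball⟩, ?_⟩, hball⟩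
  rintro ρ ⟨c, hc⟩
  rcases le_or_gt ρ 0 with h | h
  · linarith
  have h1 : ∀ j, ‖P j - c‖ ≤ 1 - ρ := fun j =>
    norm_add_le_one_of_ball_subset (isCompact_diskInter P).isClosed h hc fun y hy => hy j
  have j := Classical.arbitrary ι
  have := le_of_zero_mem_convexHull (R := 1 - r) (ρ := 1 - ρ) (c := c)
    ((norm_nonneg _).trans (hP j)) ((norm_nonneg _).trans (h1 j)) h0 (fun x hx => (hS x hx).2)
    (by intro x hx; obtain ⟨⟨i, rfl⟩, -⟩ := hS x hx; exact h1 i)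
  linarith

theorem exists_planeDot_pos {S : Set ℂ} (hS : S.Finite) (h0 : (0 : ℂ) ∉ convexHull ℝ S) :
    ∃ v : ℂ, ∀ x ∈ S, 0 < planeDot v x := by
  obtain ⟨f, u, h1, h2⟩ := geometric_hahn_banach_point_closed (convex_convexHull ℝ S)
    (hS.isClosed_convexHull ℝ) h0
  rw [map_zero] at h1
  refine ⟨⟨f 1, f Complex.I⟩, fun x hx => ?_⟩
  have h3 := h2 x (subset_convexHull ℝ S hx)
  have h4 : f x = f 1 * x.re + f Complex.I * x.im := by
    have : x = x.re • (1 : ℂ) + x.im • Complex.I := by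
      apply Complex.ext <;> simp
    conv_lhs => rw [this, map_add, map_smul, map_smul]
    simp [mul_comm]
  simp only [planeDot]
  linarith

/-- The vertices on the outer circle surround the origin. -/
theorem zero_mem_convexHull_outer {ι : Type*} [Finite ι] {P : ι → ℂ} {r : ℝ}
    (hP : ∀ j, ‖P j‖ ≤ 1 - r) (hr : HasInradius (diskInter P) r) :
    (0 : ℂ) ∈ convexHull ℝ (P '' {j | ‖P j‖ = 1 - r}) := by
  by_contra hcon
  obtain ⟨v, hv⟩ := exists_planeDot_pos ((Set.toFinite _).image P) hcon
  -- Shifting the centre slightly along v brings it nearer than 1 - r to every vertex: those on the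
  -- outer circle get closer, the others had room. A larger disk then fits.
  have h1 : ∀ᶠ δ : ℝ in nhdsWithin 0 (Set.Ioi 0), ∀ j, ‖P j - δ * v‖ < 1 - r := by
    rw [Filter.eventually_all]
    intro j
    rcases lt_or_eq_of_le (hP j) with h | h
    · have hc : ContinuousAt (fun δ : ℝ => ‖P j - δ * v‖) 0 := by fun_prop
      have := hc.eventually_lt_const (u := 1 - r) (by simpa using h)
      exact this.filter_mono nhdsWithin_le_nhds
    · have hd := hv (P j) ⟨j, h, rfl⟩
      have hc : ContinuousAt (fun δ : ℝ => δ * ‖v‖ ^ 2 - 2 * planeDot v (P j)) 0 := by fun_prop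
      have := hc.eventually_lt_const (u := 0) (by simpa using hd)
      filter_upwards [this.filter_mono nhdsWithin_le_nhds, self_mem_nhdsWithin] with δ h2 hδ
      have e : ‖P j - δ * v‖ ^ 2 =
          ‖P j‖ ^ 2 + δ * (δ * ‖v‖ ^ 2 - 2 * planeDot v (P j)) := by
        rw [norm_sq_eq_planeDot, norm_sq_eq_planeDot, norm_sq_eq_planeDot]
        simp [planeDot]; ring
      have h3 := mul_neg_of_pos_of_neg (Set.mem_Ioi.mp hδ) h2
      rw [← h]
      exact lt_of_pow_lt_pow_left₀ 2 (norm_nonneg _) (by linarith)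
  obtain ⟨δ, hδ⟩ := h1.exists
  have h2 : ∀ᶠ ρ : ℝ in nhdsWithin r (Set.Ioi r), ∀ j, ‖P j - δ * v‖ < 1 - ρ := by
    rw [Filter.eventually_all]
    intro j
    have hc : ContinuousAt (fun ρ : ℝ => 1 - ρ) r := by fun_prop
    exact (hc.eventually_const_lt (hδ j)).filter_mono nhdsWithin_le_nhds
  obtain ⟨ρ, hρ, hρr⟩ := (h2.and self_mem_nhdsWithin).exists
  have := hr.2 ⟨δ * v, ball_subset_diskInter fun j => (hρ j).le⟩
  exact absurd (Set.mem_Ioi.mp hρr) (not_lt.mpr this)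

/-! ### Vertices on the outer circle and tangency -/

namespace ReuleauxPolygon

variable {N : ℕ} {r : ℝ}

theorem inradius_pos (Q : ReuleauxPolygon N) (hr : HasInradius Q.body r) : 0 < r := by
  obtain ⟨p, hp⟩ := Q.constantWidth.interior_nonempty
  obtain ⟨ε, hε, h⟩ := Metric.isOpen_iff.mp isOpen_interior p hp
  exact hε.trans_le (hr.2 ⟨p, h.trans interior_subset⟩)

theorem norm_le_of_mem_body (Q : ReuleauxPolygon N) (hr : HasCentredIncircle Q.body r) {x : ℂ}
    (hx : x ∈ Q.body) : ‖x‖ ≤ 1 - r := by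
  have := norm_add_le_one_of_ball_subset Q.constantWidth.isCompact.isClosed
    (Q.inradius_pos hr.1) hr.2 (fun y hy => Q.constantWidth.norm_sub_le hy hx)
  simpa using this

theorem norm_vertex_le (Q : ReuleauxPolygon N) (hr : HasCentredIncircle Q.body r)
    (k : ZMod (2 * N + 1)) : ‖Q.vertex k‖ ≤ 1 - r :=
  Q.norm_le_of_mem_body hr (Q.vertex_mem_body k)

theorem closedBall_subset_body (Q : ReuleauxPolygon N) (hr : HasCentredIncircle Q.body r) :
    closedBall 0 r ⊆ Q.body := by
  rw [← closure_ball (0 : ℂ) (Q.inradius_pos hr.1).ne']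
  exact Q.constantWidth.isCompact.isClosed.closure_subset_iff.mpr hr.2

/-- Every direction of Γ k gives a support line at P k, which stays outside the incircle. If P k
were at distance at most r, all these lines would be the same tangent, but the arc has more than one
direction. -/
theorem lt_norm_vertex (Q : ReuleauxPolygon N) (hr : HasCentredIncircle Q.body r)
    (k : ZMod (2 * N + 1)) : r < ‖Q.vertex k‖ := by
  have hpos := Q.inradius_pos hr.1
  have h1 : ∀ t ∈ Set.Icc (Q.α k) (Q.β k), r ≤ planeDot (unitVec t) (-Q.vertex k) := by
    intro t ht
    have hmem : -(r * unitVec t) ∈ Q.body := by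
      apply Q.closedBall_subset_body hr
      simp [abs_of_pos hpos]
    rw [Q.body_eq] at hmem
    have := Q.isUnitStar.planeDot_nonneg ht hmem
    have e : -(r * unitVec t) - Q.vertex k = -Q.vertex k - r * unitVec t := by ring
    rw [e, planeDot_sub_right, planeDot_smul_right, planeDot_unitVec_self] at this
    linarith
  by_contra hcon
  push Not at hcon
  have h2 : ∀ t ∈ Set.Icc (Q.α k) (Q.β k), ((r⁻¹ : ℝ) : ℂ) * -Q.vertex k = unitVec t := by
    intro t ht
    apply eq_of_planeDot_unitVec_ge
    · rw [norm_mul, norm_neg, Complex.norm_real, Real.norm_eq_abs, abs_of_pos (by positivity),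
        inv_mul_le_iff₀ hpos]; linarith
    · rw [planeDot_smul_right, ← inv_mul_cancel₀ hpos.ne']
      exact mul_le_mul_of_nonneg_left (h1 t ht) (by positivity)
  apply Q.isUnitStar.unitVec_α_ne_β k
  rw [← h2 _ ⟨le_rfl, (Q.α_lt_β k).le⟩, ← h2 _ ⟨(Q.α_lt_β k).le, le_rfl⟩]

/-- The arc of a vertex on the outer circle is tangent to the incircle at a relatively interior
point. -/
theorem exists_tangent (Q : ReuleauxPolygon N) (hr : HasCentredIncircle Q.body r)
    {k : ZMod (2 * N + 1)} (hk : ‖Q.vertex k‖ = 1 - r) :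
    ∃ t ∈ Set.Ioo (Q.α k) (Q.β k), Q.vertex k = -((1 - r : ℝ) * unitVec t) := by
  have hS := Q.isUnitStar
  have hR : 0 < 1 - r := by
    have := Q.lt_norm_vertex hr k; have := Q.inradius_pos hr.1; linarith
  have hRc : ((1 - r : ℝ) : ℂ) ≠ 0 := by exact_mod_cast hR.ne'
  obtain ⟨s, hs⟩ := exists_unitVec_eq (z := -(Q.vertex k / (1 - r : ℝ))) (by
    rw [norm_neg, norm_div, hk, Complex.norm_real, Real.norm_eq_abs, abs_of_pos hR,
      div_self hR.ne'])
  have hs' : Q.vertex k = -((1 - r : ℝ) * unitVec s) := by rw [hs]; field_simp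
  have hdot : planeDot (unitVec s) (Q.vertex k) = -(1 - r) := by
    have e : Q.vertex k = (-(1 - r) : ℝ) * unitVec s := by rw [hs']; push_cast; ring
    rw [e, planeDot_smul_right, planeDot_unitVec_self, mul_one]
  have hr' : ∀ x ∈ Q.body, -(1 - r) ≤ planeDot (unitVec s) x := by
    intro x hx
    have h1 := planeDot_le_norm_mul_norm (-unitVec s) x
    rw [norm_neg, norm_unitVec, one_mul, planeDot_neg_left] at h1
    linarith [Q.norm_le_of_mem_body hr hx]
  -- With the plus sign P m is extreme in the same direction as P k, so m = k, and t is not an end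
  -- of the arc because that end would be a vertex at distance r. With the minus sign P k lies on Γ
  -- m and its centre P m is at distance r. Both contradict `lt_norm_vertex`.
  obtain ⟨m, t, ht, e | e⟩ := hS.exists_arc_direction s
  · have hkm : m = k := by
      apply Q.vertex_injective
      have h1 := hS.planeDot_mem_Icc ht (Q.body_eq ▸ Q.vertex_mem_body k)
      rw [← e, hdot] at h1
      have h2 := planeDot_le_norm_mul_norm (unitVec s) (-Q.vertex m)
      have h3 : ‖((1 - r)⁻¹ : ℝ) * -Q.vertex m‖ ≤ 1 := by
        rw [norm_mul, norm_neg, Complex.norm_real, Real.norm_eq_abs, abs_of_pos (by positivity),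
          inv_mul_le_iff₀ hR]
        linarith [Q.norm_vertex_le hr m]
      have h4 := eq_of_planeDot_unitVec_ge (t := s) h3 (by
        rw [planeDot_smul_right, le_inv_mul_iff₀ hR, planeDot_comm, planeDot_neg_left, planeDot_comm]; linarith [h1.1])
      rw [hs', ← h4]
      push_cast at hRc ⊢
      field_simp
    subst hkm
    refine ⟨t, ⟨lt_of_le_of_ne ht.1 ?_, lt_of_le_of_ne ht.2 ?_⟩, by rw [← e]; exact hs'⟩
    · intro e1
      have h1 := Q.lt_norm_vertex hr (m + 1)
      rw [Q.vertex_succ, e1, ← e, hs'] at h1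
      have e2 : -((1 - r : ℝ) * unitVec s) + unitVec s = (r : ℝ) * unitVec s := by push_cast; ring
      rw [e2, norm_mul, norm_unitVec, Complex.norm_real, Real.norm_eq_abs,
        abs_of_pos (Q.inradius_pos hr.1)] at h1
      linarith
    · intro e1
      have h1 := Q.lt_norm_vertex hr (m - 1)
      rw [Q.vertex_pred, ← e1, ← e, hs'] at h1
      have e2 : -((1 - r : ℝ) * unitVec s) + unitVec s = (r : ℝ) * unitVec s := by push_cast; ring
      rw [e2, norm_mul, norm_unitVec, Complex.norm_real, Real.norm_eq_abs,
        abs_of_pos (Q.inradius_pos hr.1)] at h1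
      linarith
  · exfalso
    have h1 : Q.vertex k = Q.vertex m + unitVec t := by
      apply hS.eq_arc_point (Q.body_eq ▸ Q.vertex_mem_body k)
      have h2 := hr' _ (Q.arc_mem_body ht)
      rw [planeDot_add_right, e, planeDot_neg_left, planeDot_neg_left, planeDot_unitVec_self] at h2
      rw [e, planeDot_neg_left] at hdot
      rw [planeDot_sub_right]; linarith
    have h2 := Q.lt_norm_vertex hr m
    have h3 : Q.vertex m = (r : ℝ) * unitVec s := by
      have : unitVec t = -unitVec s := by rw [e, neg_neg]
      rw [this, hs'] at h1
      push_cast at h1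
      linear_combination -h1
    rw [h3, norm_mul, norm_unitVec, Complex.norm_real, Real.norm_eq_abs,
        abs_of_pos (Q.inradius_pos hr.1)] at h2
    linarith

theorem isTangentArc (Q : ReuleauxPolygon N) (hr : HasCentredIncircle Q.body r)
    {k : ZMod (2 * N + 1)} (hk : ‖Q.vertex k‖ = 1 - r) : Q.IsTangentArc r k := by
  obtain ⟨t, ht, e⟩ := Q.exists_tangent hr hk
  refine ⟨t, Set.Ioo_subset_Icc_self ht, ?_⟩
  rw [e]; push_cast; ring

theorem zero_mem_convexHull (Q : ReuleauxPolygon N) (hr : HasCentredIncircle Q.body r) :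
    (0 : ℂ) ∈ convexHull ℝ (Q.vertex '' {j | ‖Q.vertex j‖ = 1 - r}) :=
  zero_mem_convexHull_outer (Q.norm_vertex_le hr) (Q.body_eq ▸ hr.1)

/-- The polygon with given vertices. -/
theorem exists_of_vertices {P : ZMod (2 * N + 1) → ℂ} (hinj : Function.Injective P)
    (hlink : ∀ k, ‖P (k + 1) - P k‖ = 1) (hdist : ∀ i j, ‖P i - P j‖ ≤ 1)
    (hcross : ∀ k, 0 < planeCross (P (k + 1) - P k) (P (k - 1) - P k))
    (hr : 0 < r) (hP : ∀ k, ‖P k‖ ≤ 1 - r) : ∃ Q : ReuleauxPolygon N, Q.vertex = P := by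
  have hlink' : ∀ k, ‖P (k - 1) - P k‖ = 1 := fun k => by
    have := hlink (k - 1)
    rwa [sub_add_cancel, norm_sub_rev] at this
  have hex : ∀ k, ∃ a b : ℝ, a < b ∧ b < a + Real.pi ∧ P (k + 1) = P k + unitVec a ∧
      P (k - 1) = P k + unitVec b := by
    intro k
    obtain ⟨a, ha⟩ := exists_unitVec_eq (hlink k)
    obtain ⟨b, hb⟩ := exists_unitVec_eq (hlink' k)
    have hs : 0 < Real.sin (b - a) := by
      rw [← planeCross_unitVec, ha, hb]; exact hcross k
    -- The angle between the two edges is normalized to (-π, π]; positivity of the determinant then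
    -- puts it in (0, π).
    refine ⟨a, a + toIocMod Real.two_pi_pos (-Real.pi) (b - a), ?_⟩
    set c := toIocMod Real.two_pi_pos (-Real.pi) (b - a) with hc
    have hc1 := toIocMod_mem_Ioc Real.two_pi_pos (-Real.pi) (b - a)
    rw [← hc] at hc1
    have hc2 : c = (b - a) - toIocDiv Real.two_pi_pos (-Real.pi) (b - a) * (2 * Real.pi) := by
      rw [hc, toIocMod, zsmul_eq_mul]
    have hsc : 0 < Real.sin c := by rw [hc2, Real.sin_sub_int_mul_two_pi]; exact hs
    have h0 : 0 < c := by
      by_contra hcon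
      exact absurd hsc (not_lt.mpr
        (Real.sin_nonpos_of_nonpos_of_neg_pi_le (not_lt.mp hcon) hc1.1.le))
    have hpi : c < Real.pi := by
      apply lt_of_le_of_ne (by linarith [hc1.2])
      intro e; rw [e, Real.sin_pi] at hsc; exact lt_irrefl _ hsc
    refine ⟨by linarith, by linarith, by rw [ha]; ring, ?_⟩
    have : unitVec (a + c) = unitVec b := by
      have e : a + c = b - toIocDiv Real.two_pi_pos (-Real.pi) (b - a) * (2 * Real.pi) := by
        rw [hc2]; ring
      apply Complex.ext
      · rw [e, unitVec_re, unitVec_re, Real.cos_sub_int_mul_two_pi]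
      · rw [e, unitVec_im, unitVec_im, Real.sin_sub_int_mul_two_pi]
    rw [this, hb]; ring
  choose α β h1 h2 h3 h4 using hex
  have hS : IsUnitStar P α β := ⟨h1, h2, h3, h4, hdist⟩
  have hinter : (interior (diskInter P)).Nonempty :=
    ⟨0, interior_maximal (ball_subset_diskInter fun j => by simpa using hP j) isOpen_ball
      (mem_ball_self hr)⟩
  exact ⟨⟨diskInter P, P, α, β, hS.isConstantWidthOne hinter, hinj, h1, h3, h4,
    hS.frontier_diskInter⟩, rfl⟩

end ReuleauxPolygon

/-! ### The area of a Reuleaux polygon -/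

/-- The point at the fraction `z.re` of the segment from the origin to the point with angle `z.im`
of the unit circle centred at `p`. -/
noncomputable def sectorMap (p z : ℂ) : ℂ := z.re * (p + unitVec z.im)

/-- The derivative of `sectorMap p` at `z`. -/
noncomputable def sectorDeriv (p z : ℂ) : ℂ →L[ℝ] ℂ :=
  Complex.reCLM.smulRight (p + unitVec z.im) +
    Complex.imCLM.smulRight (z.re * (Complex.I * unitVec z.im))

theorem hasDerivAt_unitVec (t : ℝ) : HasDerivAt unitVec (Complex.I * unitVec t) t := by
  have h1 : HasDerivAt (fun s : ℝ => (s : ℂ) * Complex.I) Complex.I t := by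
    simpa using (Complex.ofRealCLM.hasDerivAt (x := t)).mul_const Complex.I
  have := h1.cexp
  rw [mul_comm] at this
  exact this

theorem hasFDerivAt_sectorMap (p z : ℂ) : HasFDerivAt (sectorMap p) (sectorDeriv p z) z := by
  have h1 : HasFDerivAt (fun w : ℂ => unitVec w.im)
      (Complex.imCLM.smulRight (Complex.I * unitVec z.im)) z := by
    have := (hasDerivAt_unitVec z.im).hasFDerivAt.comp z Complex.imCLM.hasFDerivAt
    refine this.congr_fderiv ?_
    ext v; simp
  have h2 : HasFDerivAt (fun w : ℂ => (w.re : ℂ)) (Complex.ofRealCLM.comp Complex.reCLM) z :=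
    (Complex.ofRealCLM.comp Complex.reCLM).hasFDerivAt
  have h3 := h2.mul (h1.const_add p)
  refine h3.congr_fderiv ?_
  ext v
  simp [sectorDeriv]
  ring

theorem det_sectorDeriv (p z : ℂ) :
    (sectorDeriv p z).det = z.re * (1 + planeDot p (unitVec z.im)) := by
  have h : (sectorDeriv p z).det = LinearMap.det (sectorDeriv p z : ℂ →ₗ[ℝ] ℂ) := rfl
  rw [h, ← LinearMap.det_toMatrix Complex.basisOneI, Matrix.det_fin_two]
  simp only [LinearMap.toMatrix_apply, Complex.coe_basisOneI, Complex.coe_basisOneI_repr]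
  simp [sectorDeriv, planeDot]
  linear_combination z.re * Real.sin_sq_add_cos_sq z.im

theorem integral_one_add_planeDot (p : ℂ) (a b : ℝ) :
    ∫ t in a..b, (1 + planeDot p (unitVec t)) =
      b - a + planeCross p (unitVec b - unitVec a) := by
  have hder : ∀ t ∈ Set.uIcc a b, HasDerivAt
      (fun t => t + (p.re * Real.sin t - p.im * Real.cos t)) (1 + planeDot p (unitVec t)) t := by
    intro t _
    have := (hasDerivAt_id t).add (((Real.hasDerivAt_sin t).const_mul p.re).sub
      ((Real.hasDerivAt_cos t).const_mul p.im))
    refine this.congr_deriv ?_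
    simp only [planeDot, unitVec_re, unitVec_im]
    ring
  rw [intervalIntegral.integral_eq_sub_of_hasDerivAt hder]
  · simp [planeCross]; ring
  · apply Continuous.intervalIntegrable
    simp only [planeDot, unitVec_re, unitVec_im]
    fun_prop

/-- Change of variables: the Jacobian is a product of the radial fraction, which integrates to 1/2,
and of a factor depending on the angle alone. -/
theorem volume_sector {p : ℂ} {a b : ℝ} (hab : a ≤ b)
    (hpos : ∀ t ∈ Set.Ioo a b, 0 ≤ 1 + planeDot p (unitVec t))
    (hinj : Set.InjOn (sectorMap p) (Set.Ioo 0 1 ×ℂ Set.Ioo a b)) :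
    volume (sectorMap p '' (Set.Ioo 0 1 ×ℂ Set.Ioo a b)) =
      ENNReal.ofReal ((b - a + planeCross p (unitVec b - unitVec a)) / 2) := by
  have hmeas : MeasurableSet (Set.Ioo (0 : ℝ) 1 ×ℂ Set.Ioo a b) :=
    (isOpen_Ioo.reProdIm isOpen_Ioo).measurableSet
  rw [← lintegral_abs_det_fderiv_eq_addHaar_image volume hmeas
    (fun z _ => (hasFDerivAt_sectorMap p z).hasFDerivWithinAt) hinj]
  have h1 : ∫⁻ z in Set.Ioo (0 : ℝ) 1 ×ℂ Set.Ioo a b,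
        ENNReal.ofReal |(sectorDeriv p z).det| =
      ∫⁻ z in Set.Ioo (0 : ℝ) 1 ×ℂ Set.Ioo a b,
        ENNReal.ofReal z.re * ENNReal.ofReal (1 + planeDot p (unitVec z.im)) := by
    refine setLIntegral_congr_fun hmeas fun z hz => ?_
    have hz1 : z.re ∈ Set.Ioo (0 : ℝ) 1 := hz.1
    have hz2 := hpos z.im hz.2
    rw [det_sectorDeriv, abs_of_nonneg (mul_nonneg hz1.1.le hz2), ENNReal.ofReal_mul hz1.1.le]
  have h2 : ∫⁻ z in Set.Ioo (0 : ℝ) 1 ×ℂ Set.Ioo a b,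
        ENNReal.ofReal z.re * ENNReal.ofReal (1 + planeDot p (unitVec z.im)) =
      ∫⁻ q in Set.Ioo (0 : ℝ) 1 ×ˢ Set.Ioo a b,
        ENNReal.ofReal q.1 * ENNReal.ofReal (1 + planeDot p (unitVec q.2)) := by
    have := Complex.volume_preserving_equiv_real_prod.setLIntegral_comp_preimage_emb
      Complex.measurableEquivRealProd.measurableEmbedding
      (fun q => ENNReal.ofReal q.1 * ENNReal.ofReal (1 + planeDot p (unitVec q.2)))
      (Set.Ioo (0 : ℝ) 1 ×ˢ Set.Ioo a b)
    rw [← this]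
    rfl
  have hcont : Continuous fun t => 1 + planeDot p (unitVec t) := by
    simp only [planeDot, unitVec_re, unitVec_im]; fun_prop
  rw [h1, h2, Measure.volume_eq_prod, ← Measure.prod_restrict,
    lintegral_prod_mul (f := fun x => ENNReal.ofReal x)
      (g := fun t => ENNReal.ofReal (1 + planeDot p (unitVec t))) (by fun_prop)
      hcont.measurable.ennreal_ofReal.aemeasurable]
  have h3 : ∫⁻ x in Set.Ioo (0 : ℝ) 1, ENNReal.ofReal x = ENNReal.ofReal (1 / 2) := by
    rw [← ofReal_integral_eq_lintegral_ofReal]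
    · rw [← integral_Ioc_eq_integral_Ioo, ← intervalIntegral.integral_of_le zero_le_one]
      simp
    · exact (continuous_id.integrableOn_Icc (a := 0) (b := 1)).mono_set Set.Ioo_subset_Icc_self
    · filter_upwards [ae_restrict_mem measurableSet_Ioo] with x hx using hx.1.le
  have h4 : ∫⁻ t in Set.Ioo a b, ENNReal.ofReal (1 + planeDot p (unitVec t)) =
      ENNReal.ofReal (b - a + planeCross p (unitVec b - unitVec a)) := by
    rw [← ofReal_integral_eq_lintegral_ofReal]
    · rw [← integral_Ioc_eq_integral_Ioo, ← intervalIntegral.integral_of_le hab,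
        integral_one_add_planeDot]
    · exact (hcont.integrableOn_Icc (a := a) (b := b)).mono_set Set.Ioo_subset_Icc_self
    · filter_upwards [ae_restrict_mem measurableSet_Ioo] with t ht using hpos t ht
  rw [h3, h4, ← ENNReal.ofReal_mul (by norm_num)]
  congr 1; ring

/-- A ray from an interior point of a convex set meets the frontier at most once. -/
theorem eq_of_smul_eq_of_mem_frontier {K : Set ℂ} (hK : Convex ℝ K) (hc : IsClosed K)
    (h0 : (0 : ℂ) ∈ interior K) {x y : ℂ} (hx : x ∈ frontier K) (hy : y ∈ frontier K) {c d : ℝ}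
    (hc0 : 0 < c) (hd0 : 0 < d) (h : (c : ℂ) * x = d * y) : c = d ∧ x = y := by
  have key : ∀ {x y : ℂ} {c d : ℝ}, x ∈ frontier K → y ∈ frontier K → 0 < c → 0 < d →
      (c : ℂ) * x = d * y → ¬ c < d := by
    intro x y c d hx hy hc0 hd0 h hcd
    have hd0' : (d : ℂ) ≠ 0 := by exact_mod_cast hd0.ne'
    have e : y = ((c / d : ℝ) : ℂ) * x := by
      push_cast; field_simp; linear_combination -h
    refine hy.2 (hK.openSegment_interior_self_subset_interior h0 (hc.frontier_subset hx) ?_)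
    refine ⟨1 - c / d, c / d, ?_, by positivity, by ring, by rw [e]; simp⟩
    rw [sub_pos, div_lt_one hd0]; exact hcd
  have e : c = d := le_antisymm (not_lt.mp (key hy hx hd0 hc0 h.symm)) (not_lt.mp (key hx hy hc0 hd0 h))
  refine ⟨e, ?_⟩
  subst e
  exact mul_left_cancel₀ (by exact_mod_cast hc0.ne') h

/-- A nonzero point of a compact set lies on a segment from the origin to a frontier point. -/
theorem exists_frontier_smul {K : Set ℂ} (hK : IsCompact K) {x : ℂ}
    (hx : x ∈ K) (hx0 : x ≠ 0) : ∃ y ∈ frontier K, ∃ c ∈ Set.Ioc (0 : ℝ) 1, x = c * y := by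
  set T := {s : ℝ | (s : ℂ) * x ∈ K} with hT
  have hTc : IsClosed T := hK.isClosed.preimage (by fun_prop)
  obtain ⟨M, hM⟩ := hK.isBounded.exists_norm_le
  have hxn : 0 < ‖x‖ := norm_pos_iff.mpr hx0
  have hTb : BddAbove T := by
    refine ⟨M / ‖x‖, fun s hs => ?_⟩
    have := hM _ hs
    rw [norm_mul, Complex.norm_real, Real.norm_eq_abs] at this
    rw [le_div_iff₀ hxn]
    nlinarith [le_abs_self s]
  have h1 : (1 : ℝ) ∈ T := by simpa [hT] using hx
  have hs := hTc.csSup_mem ⟨1, h1⟩ hTb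
  have hs1 : 1 ≤ sSup T := le_csSup hTb h1
  set s := sSup T
  have hs0 : 0 < s := by linarith
  refine ⟨s * x, ⟨subset_closure hs, fun hinter => ?_⟩, s⁻¹, ⟨by positivity, inv_le_one_of_one_le₀ hs1⟩, ?_⟩
  · have hcont : ContinuousAt (fun τ : ℝ => (τ : ℂ) * x) s := by fun_prop
    have hev := hcont.eventually (isOpen_interior.mem_nhds hinter)
    obtain ⟨τ, hτ, hτs⟩ := ((hev.filter_mono nhdsWithin_le_nhds).and
      (self_mem_nhdsWithin (s := Set.Ioi s))).exists
    exact absurd (Set.mem_Ioi.mp hτs) (not_lt.mpr (le_csSup hTb (show (τ : ℂ) * x ∈ K from interior_subset (s := K) hτ)))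
  · have : (s : ℂ) ≠ 0 := by exact_mod_cast hs0.ne'
    push_cast; field_simp

theorem volume_line_eq_zero (v : ℂ) : volume (Set.range fun c : ℝ => (c : ℂ) * v) = 0 := by
  have h1 : (Set.range fun c : ℝ => (c : ℂ) * v) ⊆ (Submodule.span ℝ {v} : Submodule ℝ ℂ) := by
    rintro _ ⟨c, rfl⟩
    rw [SetLike.mem_coe, Submodule.mem_span_singleton]
    exact ⟨c, by simp⟩
  refine measure_mono_null h1 (Measure.addHaar_submodule volume _ fun htop => ?_)
  have h2 : Module.finrank ℝ (Submodule.span ℝ {v} : Submodule ℝ ℂ) ≤ 1 :=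
    (finrank_span_le_card ({v} : Set ℂ)).trans (by simp)
  rw [htop, finrank_top, Complex.finrank_real_complex] at h2
  omega

namespace ReuleauxPolygon

variable {N : ℕ} {r : ℝ}

/-- The open sector of the arc `Γ k` seen from the origin. -/
def sector (Q : ReuleauxPolygon N) (k : ZMod (2 * N + 1)) : Set ℂ :=
  sectorMap (Q.vertex k) '' (Set.Ioo 0 1 ×ℂ Set.Ioo (Q.α k) (Q.β k))

theorem arc_mem_frontier (Q : ReuleauxPolygon N) {k : ZMod (2 * N + 1)} {t : ℝ}
    (ht : t ∈ Set.Icc (Q.α k) (Q.β k)) : Q.vertex k + unitVec t ∈ frontier Q.body := by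
  rw [Q.frontier_eq]
  exact Set.mem_iUnion.mpr ⟨k, t, ht, rfl⟩

theorem eq_of_arc_point_eq (Q : ReuleauxPolygon N) {i j : ZMod (2 * N + 1)} {s t : ℝ}
    (hs : s ∈ Set.Ioo (Q.α i) (Q.β i)) (ht : t ∈ Set.Ioo (Q.α j) (Q.β j))
    (h : Q.vertex i + unitVec s = Q.vertex j + unitVec t) : i = j ∧ s = t := by
  have hS := Q.isUnitStar
  have e : unitVec s = unitVec t := by
    apply hS.normal_unique ht
    intro x hx
    rw [← h, planeDot_add_right, planeDot_unitVec_self]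
    exact (hS.planeDot_mem_Icc (Set.Ioo_subset_Icc_self hs) hx).2
  have hij : i = j := by
    apply Q.vertex_injective
    rw [e] at h
    exact add_right_cancel h
  refine ⟨hij, ?_⟩
  subst hij
  have h1 : Real.sin (s - t) = 0 := by
    rw [← planeCross_unitVec, e]; simp [planeCross, mul_comm]
  have h2 := hS.lt_add_pi i
  have := (Real.sin_eq_zero_iff_of_lt_of_lt (by linarith [hs.1, ht.2]) (by linarith [hs.2, ht.1])).mp h1
  linarith

/-- A ray from the origin meets the boundary once, and a relatively interior point of an arc
determines its label and angle. This gives both injectivity on a sector and disjointness of the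
sectors. -/
theorem sectorMap_eq (Q : ReuleauxPolygon N) (h0 : (0 : ℂ) ∈ interior Q.body)
    {i j : ZMod (2 * N + 1)} {z w : ℂ} (hz : z ∈ Set.Ioo 0 1 ×ℂ Set.Ioo (Q.α i) (Q.β i))
    (hw : w ∈ Set.Ioo 0 1 ×ℂ Set.Ioo (Q.α j) (Q.β j))
    (h : sectorMap (Q.vertex i) z = sectorMap (Q.vertex j) w) : i = j ∧ z = w := by
  have hz1 : z.re ∈ Set.Ioo (0 : ℝ) 1 := hz.1
  have hz2 : z.im ∈ Set.Ioo (Q.α i) (Q.β i) := hz.2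
  have hw1 : w.re ∈ Set.Ioo (0 : ℝ) 1 := hw.1
  have hw2 : w.im ∈ Set.Ioo (Q.α j) (Q.β j) := hw.2
  obtain ⟨h1, h2⟩ := eq_of_smul_eq_of_mem_frontier Q.constantWidth.convex
    Q.constantWidth.isCompact.isClosed h0 (Q.arc_mem_frontier (Set.Ioo_subset_Icc_self hz2))
    (Q.arc_mem_frontier (Set.Ioo_subset_Icc_self hw2)) hz1.1 hw1.1 h
  obtain ⟨h3, h4⟩ := Q.eq_of_arc_point_eq hz2 hw2 h2
  exact ⟨h3, Complex.ext h1 h4⟩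

theorem sector_subset_body (Q : ReuleauxPolygon N) (h0 : (0 : ℂ) ∈ interior Q.body)
    (k : ZMod (2 * N + 1)) : Q.sector k ⊆ Q.body := by
  rintro _ ⟨z, hz, rfl⟩
  have hz1 : z.re ∈ Set.Ioo (0 : ℝ) 1 := hz.1
  have hz2 : z.im ∈ Set.Ioo (Q.α k) (Q.β k) := hz.2
  have := Q.constantWidth.convex (interior_subset h0) (Q.arc_mem_body (Set.Ioo_subset_Icc_self hz2))
    (a := 1 - z.re) (b := z.re) (by linarith [hz1.2]) hz1.1.le (by ring)
  simpa [sectorMap, mul_add] using this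

theorem body_diff_subset (Q : ReuleauxPolygon N) :
    Q.body \ ⋃ k, Q.sector k ⊆
      frontier Q.body ∪ ⋃ k, Set.range fun c : ℝ => (c : ℂ) * Q.vertex k := by
  rintro x ⟨hx, hxs⟩
  rcases eq_or_ne x 0 with rfl | hx0
  · right; exact Set.mem_iUnion.mpr ⟨0, 0, by simp⟩
  obtain ⟨y, hy, c, hc, rfl⟩ := exists_frontier_smul Q.constantWidth.isCompact hx hx0
  rcases eq_or_lt_of_le hc.2 with e | hc1
  · left; simpa [e] using hy
  right
  have hy' := hy
  rw [Q.frontier_eq] at hy'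
  obtain ⟨k, t, ht, rfl⟩ := Set.mem_iUnion.mp hy'
  simp only at *
  rcases eq_or_lt_of_le ht.1 with e | h1
  · exact Set.mem_iUnion.mpr ⟨k + 1, c, by simp only [Q.vertex_succ, e]⟩
  rcases eq_or_lt_of_le ht.2 with e | h2
  · exact Set.mem_iUnion.mpr ⟨k - 1, c, by simp only [Q.vertex_pred, e]⟩
  · exact (hxs (Set.mem_iUnion.mpr ⟨k, ⟨c, t⟩, ⟨⟨hc.1, hc1⟩, ⟨h1, h2⟩⟩, rfl⟩)).elim

theorem volume_body_eq_sum (Q : ReuleauxPolygon N) (h0 : (0 : ℂ) ∈ interior Q.body) :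
    volume Q.body = ∑ k, volume (Q.sector k) := by
  have hmeas : ∀ k, MeasurableSet (Q.sector k) := fun k =>
    measurable_image_of_fderivWithin (isOpen_Ioo.reProdIm isOpen_Ioo).measurableSet
      (fun z _ => (hasFDerivAt_sectorMap (Q.vertex k) z).hasFDerivWithinAt)
      (fun z hz w hw h => (Q.sectorMap_eq h0 hz hw h).2)
  have hdisj : Pairwise (Function.onFun Disjoint Q.sector) := by
    intro i j hij
    rw [Function.onFun, Set.disjoint_left]
    rintro _ ⟨z, hz, rfl⟩ ⟨w, hw, h⟩
    exact hij (Q.sectorMap_eq h0 hw hz h).1.symm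
  have h1 : volume (⋃ k, Q.sector k) = ∑ k, volume (Q.sector k) := by
    rw [measure_iUnion hdisj hmeas, tsum_fintype]
  rw [← h1]
  apply le_antisymm
  · have hnull : volume (Q.body \ ⋃ k, Q.sector k) = 0 := by
      refine measure_mono_null Q.body_diff_subset (measure_union_null ?_ ?_)
      · exact Q.constantWidth.convex.addHaar_frontier volume
      · exact measure_iUnion_null fun k => volume_line_eq_zero _
    calc volume Q.body ≤ volume ((⋃ k, Q.sector k) ∪ (Q.body \ ⋃ k, Q.sector k)) :=
          measure_mono (by rw [Set.union_sdiff_self]; exact Set.subset_union_right)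
      _ ≤ _ := measure_union_le _ _
      _ = _ := by rw [hnull, add_zero]
  · exact measure_mono (Set.iUnion_subset (Q.sector_subset_body h0))

theorem planeCross_sub_right (z w v : ℂ) : planeCross z (w - v) = planeCross z w - planeCross z v := by
  simp only [planeCross, Complex.sub_re, Complex.sub_im]; ring

theorem planeCross_comm (z w : ℂ) : planeCross z w = -planeCross w z := by
  simp only [planeCross]; ring

/-- The area of a Reuleaux polygon. -/
theorem volume_body (Q : ReuleauxPolygon N) (hr : HasCentredIncircle Q.body r) :
    volume Q.body = ENNReal.ofReal
      (Real.pi / 2 - ∑ k, planeCross (Q.vertex k) (Q.vertex (k + 1))) := by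
  have h0 : (0 : ℂ) ∈ interior Q.body :=
    interior_maximal hr.2 isOpen_ball (mem_ball_self (Q.inradius_pos hr.1))
  have hpos : ∀ k t, 0 ≤ 1 + planeDot (Q.vertex k) (unitVec t) := by
    intro k t
    have h1 := planeDot_le_norm_mul_norm (-Q.vertex k) (unitVec t)
    rw [norm_neg, norm_unitVec, mul_one, planeDot_neg_left] at h1
    linarith [Q.norm_vertex_le hr k, Q.inradius_pos hr.1]
  have hsec : ∀ k, volume (Q.sector k) = ENNReal.ofReal ((Q.β k - Q.α k +
      planeCross (Q.vertex k) (unitVec (Q.β k) - unitVec (Q.α k))) / 2) := fun k =>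
    volume_sector (Q.α_lt_β k).le (fun t _ => hpos k t)
      (fun z hz w hw h => (Q.sectorMap_eq h0 hz hw h).2)
  have hnn : ∀ k, 0 ≤ (Q.β k - Q.α k +
      planeCross (Q.vertex k) (unitVec (Q.β k) - unitVec (Q.α k))) / 2 := by
    intro k
    rw [← integral_one_add_planeDot]
    exact div_nonneg (intervalIntegral.integral_nonneg (Q.α_lt_β k).le fun t _ => hpos k t)
      zero_le_two
  rw [Q.volume_body_eq_sum h0, Finset.sum_congr rfl fun k _ => hsec k,
    ← ENNReal.ofReal_sum_of_nonneg fun k _ => hnn k]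
  congr 1
  -- Each edge of the star enters twice, from the arcs centred at its two ends, with the same sign
  -- after `planeCross_comm`; so the halves add up to a full determinant.
  have hterm : ∀ k, (Q.β k - Q.α k +
      planeCross (Q.vertex k) (unitVec (Q.β k) - unitVec (Q.α k))) / 2 =
      (Q.β k - Q.α k) / 2 - planeCross (Q.vertex (k - 1)) (Q.vertex k) / 2 -
        planeCross (Q.vertex k) (Q.vertex (k + 1)) / 2 := by
    intro k
    have e : unitVec (Q.β k) - unitVec (Q.α k) = Q.vertex (k - 1) - Q.vertex (k + 1) := by
      rw [Q.vertex_pred, Q.vertex_succ]; ring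
    rw [e, planeCross_sub_right, planeCross_comm (Q.vertex k) (Q.vertex (k - 1))]; ring
  have hshift : ∑ k, planeCross (Q.vertex (k - 1)) (Q.vertex k) =
      ∑ k, planeCross (Q.vertex k) (Q.vertex (k + 1)) := by
    rw [← Equiv.sum_comp (Equiv.addRight (1 : ZMod (2 * N + 1)))]
    simp
  rw [Finset.sum_congr rfl fun k _ => hterm k, Finset.sum_sub_distrib, Finset.sum_sub_distrib,
    ← Finset.sum_div, ← Finset.sum_div, ← Finset.sum_div, hshift,
    Q.isUnitStar.sum_angles Q.vertex_injective]
  ring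

end ReuleauxPolygon

/-! ### Three-bar linkages -/

open Filter Topology

theorem HasDerivAt.planeDot {f g : ℝ → ℂ} {f' g' : ℂ} {t : ℝ} (hf : HasDerivAt f f' t)
    (hg : HasDerivAt g g' t) : HasDerivAt (fun s => planeDot (f s) (g s))
      (planeDot f' (g t) + planeDot (f t) g') t := by
  have hfr : HasDerivAt (fun s => (f s).re) f'.re t :=
    Complex.reCLM.hasFDerivAt.comp_hasDerivAt t hf
  have hfi : HasDerivAt (fun s => (f s).im) f'.im t :=
    Complex.imCLM.hasFDerivAt.comp_hasDerivAt t hf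
  have hgr : HasDerivAt (fun s => (g s).re) g'.re t :=
    Complex.reCLM.hasFDerivAt.comp_hasDerivAt t hg
  have hgi : HasDerivAt (fun s => (g s).im) g'.im t :=
    Complex.imCLM.hasFDerivAt.comp_hasDerivAt t hg
  refine ((hfr.mul hgr).add (hfi.mul hgi)).congr_deriv ?_
  simp only [_root_.planeDot]; ring

theorem HasDerivAt.planeCross {f g : ℝ → ℂ} {f' g' : ℂ} {t : ℝ} (hf : HasDerivAt f f' t)
    (hg : HasDerivAt g g' t) : HasDerivAt (fun s => planeCross (f s) (g s))
      (planeCross f' (g t) + planeCross (f t) g') t := by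
  have hfr : HasDerivAt (fun s => (f s).re) f'.re t :=
    Complex.reCLM.hasFDerivAt.comp_hasDerivAt t hf
  have hfi : HasDerivAt (fun s => (f s).im) f'.im t :=
    Complex.imCLM.hasFDerivAt.comp_hasDerivAt t hf
  have hgr : HasDerivAt (fun s => (g s).re) g'.re t :=
    Complex.reCLM.hasFDerivAt.comp_hasDerivAt t hg
  have hgi : HasDerivAt (fun s => (g s).im) g'.im t :=
    Complex.imCLM.hasFDerivAt.comp_hasDerivAt t hg
  refine ((hfr.mul hgi).sub (hfi.mul hgr)).congr_deriv ?_
  simp only [_root_.planeCross]; ring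

theorem ContinuousAt.planeCross {f g : ℝ → ℂ} {t : ℝ} (hf : ContinuousAt f t)
    (hg : ContinuousAt g t) : ContinuousAt (fun s => planeCross (f s) (g s)) t := by
  unfold _root_.planeCross; fun_prop

/-- A point `y` at unit distance from both `x` and `b`. -/
noncomputable def linkPoint (b x : ℂ) : ℂ :=
  x + (b - x) * (1 / 2 - √(1 / Complex.normSq (b - x) - 1 / 4) * Complex.I)

theorem norm_linkPoint {b x : ℂ} (hbx : b ≠ x) (h : ‖b - x‖ ≤ 2) :
    ‖linkPoint b x - x‖ = 1 ∧ ‖linkPoint b x - b‖ = 1 := by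
  have hpos : 0 < Complex.normSq (b - x) := Complex.normSq_pos.mpr (sub_ne_zero.mpr hbx)
  have hle : Complex.normSq (b - x) ≤ 4 := by
    rw [Complex.normSq_eq_norm_sq]; nlinarith [norm_nonneg (b - x)]
  have hs : 0 ≤ 1 / Complex.normSq (b - x) - 1 / 4 := by
    rw [sub_nonneg]; exact one_div_le_one_div_of_le hpos hle
  have hsq := Real.sq_sqrt hs
  set s := √(1 / Complex.normSq (b - x) - 1 / 4)
  have hprod : Complex.normSq (b - x) * (1 / 4 + s ^ 2) = 1 := by rw [hsq]; field_simp; ring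
  have key : ∀ z : ℂ, Complex.normSq z = 1 → ‖z‖ = 1 := fun z hz => by
    rw [Complex.normSq_eq_norm_sq] at hz
    nlinarith [norm_nonneg z]
  constructor
  · apply key
    have e : linkPoint b x - x = (b - x) * (1 / 2 - s * Complex.I) := by rw [linkPoint]; ring
    rw [e, Complex.normSq_mul, ← hprod]
    congr 1
    simp [Complex.normSq_apply]; ring
  · apply key
    have e : linkPoint b x - b = (b - x) * (-1 / 2 - s * Complex.I) := by rw [linkPoint]; ring
    rw [e, Complex.normSq_mul, ← hprod]
    congr 1
    simp [Complex.normSq_apply]; ring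

/-- Two points are at unit distance from both `b` and `x`, one on each side of the line through
them; the sign of the determinant selects the one given by the formula. -/
theorem linkPoint_eq {b x y : ℂ} (h1 : ‖y - x‖ = 1) (h2 : ‖y - b‖ = 1)
    (h3 : 0 < planeCross (b - y) (x - y)) : linkPoint b x = y := by
  have hbx : b - x ≠ 0 := by
    intro e
    rw [sub_eq_zero.mp e] at h3
    simp [planeCross, mul_comm] at h3
  have hpos : 0 < Complex.normSq (b - x) := Complex.normSq_pos.mpr hbx
  obtain ⟨ζ, hζ⟩ : ∃ ζ : ℂ, y - x = (b - x) * ζ := ⟨(y - x) / (b - x), by field_simp⟩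
  have hy : y = x + (b - x) * ζ := by rw [← hζ]; ring
  have n1 : Complex.normSq (b - x) * Complex.normSq ζ = 1 := by
    rw [← Complex.normSq_mul, ← hζ, Complex.normSq_eq_norm_sq, h1, one_pow]
  have n2 : Complex.normSq (b - x) * Complex.normSq (ζ - 1) = 1 := by
    rw [← Complex.normSq_mul, mul_sub, ← hζ, Complex.normSq_eq_norm_sq,
      show y - x - (b - x) * 1 = y - b by ring, h2, one_pow]
  have hre : ζ.re = 1 / 2 := by
    have : Complex.normSq ζ = Complex.normSq (ζ - 1) :=
      mul_left_cancel₀ hpos.ne' (n1.trans n2.symm)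
    simp [Complex.normSq_apply] at this
    linarith
  have hcr : planeCross (b - y) (x - y) = -(Complex.normSq (b - x) * ζ.im) := by
    rw [show b - y = (b - x) * (1 - ζ) by rw [hy]; ring,
      show x - y = -((b - x) * ζ) by rw [hy]; ring]
    simp only [planeCross, Complex.normSq_apply, Complex.mul_re, Complex.mul_im, Complex.neg_re,
      Complex.neg_im, Complex.sub_re (1 : ℂ), Complex.sub_im (1 : ℂ), Complex.one_re, Complex.one_im]
    ring
  have him : ζ.im < 0 := by rw [hcr] at h3; nlinarith
  have hsq : √(1 / Complex.normSq (b - x) - 1 / 4) = -ζ.im := by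
    have hinv : 1 / Complex.normSq (b - x) = Complex.normSq ζ := by
      rw [div_eq_iff hpos.ne', mul_comm]; exact n1.symm
    rw [hinv, Complex.normSq_apply, hre, show 1 / 2 * (1 / 2) + ζ.im * ζ.im - 1 / 4 = (-ζ.im) ^ 2 by
      ring]
    exact Real.sqrt_sq (by linarith)
  rw [linkPoint, hsq, hy]
  congr 2
  apply Complex.ext <;> simp [hre]

theorem differentiableAt_linkPoint {b : ℂ} {x : ℝ → ℂ} {t : ℝ} (hx : DifferentiableAt ℝ x t)
    (hbx : b ≠ x t) (h : ‖b - x t‖ < 2) : DifferentiableAt ℝ (fun s => linkPoint b (x s)) t := by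
  have hpos : 0 < Complex.normSq (b - x t) := Complex.normSq_pos.mpr (sub_ne_zero.mpr hbx)
  have hlt : Complex.normSq (b - x t) < 4 := by
    rw [Complex.normSq_eq_norm_sq]; nlinarith [norm_nonneg (b - x t)]
  have hs : 0 < 1 / Complex.normSq (b - x t) - 1 / 4 := by
    rw [sub_pos]; exact one_div_lt_one_div_of_lt hpos hlt
  have hn : DifferentiableAt ℝ (fun s => Complex.normSq (b - x s)) t := by
    have e : (fun s => Complex.normSq (b - x s)) = fun s => planeDot (b - x s) (b - x s) := by
      ext s; rw [Complex.normSq_apply, planeDot]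
    rw [e]
    have := (hx.hasDerivAt.const_sub b)
    exact (this.planeDot this).differentiableAt
  have hroot : DifferentiableAt ℝ (fun s => √(1 / Complex.normSq (b - x s) - 1 / 4)) t :=
    (((differentiableAt_const (1 : ℝ)).div hn hpos.ne').sub_const _).sqrt hs.ne'
  have hrootc : DifferentiableAt ℝ
      (fun s => ((√(1 / Complex.normSq (b - x s) - 1 / 4) : ℝ) : ℂ)) t :=
    Complex.ofRealCLM.differentiableAt.comp t hroot
  unfold linkPoint
  exact hx.add (((differentiableAt_const b).sub hx).mul
    ((differentiableAt_const _).sub (hrootc.mul_const _)))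

/-- First order identities for a chain of three unit vectors `f`, `e`, `-v` with fixed ends, the
first of which rotates with unit speed and the last with speed `ω`. -/
theorem linkage_velocity {e f v w : ℂ} (hv : planeDot v v = 1) (hw : planeDot w v = 0)
    (hwe : planeDot (w - Complex.I * f) e = 0) :
    ∃ ω : ℝ, w = ω * (Complex.I * v) ∧ ω * planeCross v e = planeCross f e := by
  have h1 : w = (planeCross v w : ℝ) * (Complex.I * v) := by
    simp only [planeDot] at hv hw
    apply Complex.ext
    · simp [planeCross]
      linear_combination (-w.re) * hv + v.re * hw
    · simp [planeCross]
      linear_combination (-w.im) * hv + v.im * hw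
  refine ⟨planeCross v w, h1, ?_⟩
  generalize planeCross v w = ω at h1
  rw [h1] at hwe
  simp [planeDot] at hwe
  simp only [planeCross]
  linear_combination hwe

theorem lagrange_identity (e f : ℂ) :
    planeCross f e ^ 2 = planeDot e e * planeDot f f - planeDot e f ^ 2 := by
  simp only [planeCross, planeDot]; ring

/-- With p = 1 - cos θ and S = sin θ, the ratio p / S is tan (θ / 2), which increases with p. -/
theorem mul_lt_mul_of_sq_eq {p q S T : ℝ} (hS : 0 < S) (hS2 : S ^ 2 = 2 * p - p ^ 2)
    (hT2 : T ^ 2 = 2 * q - q ^ 2) (hpq : p < q) : p * T < q * S := by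
  have hp : 0 < p := by nlinarith
  have hq : 0 < q := hp.trans hpq
  apply lt_of_pow_lt_pow_left₀ 2 (by positivity)
  have : (q * S) ^ 2 - (p * T) ^ 2 = 2 * (p * q) * (q - p) := by
    rw [mul_pow, mul_pow, hS2, hT2]; ring
  have := mul_pos (mul_pos two_pos (mul_pos hp hq)) (sub_pos.mpr hpq)
  linarith

/-- The sign of the derivative of the area of a chain of three unit vectors. -/
theorem linkage_area_deriv {e f v w : ℂ} (he : planeDot e e = 1) (hf : planeDot f f = 1)
    (hv : planeDot v v = 1) (hfe : 0 < planeCross f e) (hve : 0 < planeCross v e)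
    (hw : planeDot w v = 0) (hwe : planeDot (w - Complex.I * f) e = 0) :
    (planeDot e (f + v) < 0 →
      0 < planeCross (Complex.I * f) (e + f) + planeCross w (e - v)) ∧
    (0 < planeDot e (f + v) →
      planeCross (Complex.I * f) (e + f) + planeCross w (e - v) < 0) := by
  obtain ⟨ω, hω, hω2⟩ := linkage_velocity hv hw hwe
  have hval : planeCross (Complex.I * f) (e + f) + planeCross w (e - v) =
      -(1 + planeDot e f) + ω * (1 - planeDot e v) := by
    have h1 : planeCross (Complex.I * f) (e + f) + planeCross w (e - v) =
        -(planeDot f f + planeDot e f) + ω * (planeDot v v - planeDot e v) := by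
      rw [hω]
      simp [planeCross, planeDot]; ring
    rw [h1, hf, hv]
  have hS2 : planeCross f e ^ 2 = 2 * (1 + planeDot e f) - (1 + planeDot e f) ^ 2 := by
    rw [lagrange_identity, he, hf]; ring
  have hT2 : planeCross v e ^ 2 = 2 * (1 - planeDot e v) - (1 - planeDot e v) ^ 2 := by
    rw [lagrange_identity, he, hv]; ring
  -- Multiplying by the positive determinant of v and e removes the speed ω; what is left is the
  -- comparison of two half-angle tangents.
  have hmul : (-(1 + planeDot e f) + ω * (1 - planeDot e v)) * planeCross v e =
      (1 - planeDot e v) * planeCross f e - (1 + planeDot e f) * planeCross v e := by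
    rw [← hω2]; ring
  rw [hval, planeDot_add_right]
  constructor
  · intro h
    have := mul_lt_mul_of_sq_eq hfe hS2 hT2 (by linarith)
    exact pos_of_mul_pos_left (by rw [hmul]; linarith) hve.le
  · intro h
    have := mul_lt_mul_of_sq_eq hve hT2 hS2 (by linarith)
    by_contra hcon
    have := mul_nonneg (not_lt.mp hcon) hve.le
    rw [hmul] at this
    linarith

/-- At a critical point of the area the two angles of the chain vary in opposite directions. -/
theorem linkage_angle_deriv {e f v w : ℂ} (he : planeDot e e = 1) (hf : planeDot f f = 1)
    (hv : planeDot v v = 1) (hfe : 0 < planeCross f e) (hve : 0 < planeCross v e)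
    (hw : planeDot w v = 0) (hwe : planeDot (w - Complex.I * f) e = 0)
    (h0 : planeDot e (f + v) = 0) (hlt : planeDot (e + f) (e + f) < 1) :
    planeDot (w - Complex.I * f) (f + v) + planeDot e (Complex.I * f + w) < 0 := by
  obtain ⟨ω, hω, hω2⟩ := linkage_velocity hv hw hwe
  rw [planeDot_add_right] at h0
  have hST : planeCross v e = planeCross f e := by
    have : planeCross v e ^ 2 = planeCross f e ^ 2 := by
      rw [lagrange_identity, lagrange_identity, he, hf, hv]
      have : planeDot e v = -planeDot e f := by linarith
      rw [this]; ring
    exact (pow_left_inj₀ hve.le hfe.le two_ne_zero).mp this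
  have hω1 : ω = 1 := by
    rw [hST] at hω2; exact mul_right_cancel₀ hfe.ne' (by rw [hω2, one_mul])
  rw [hω1, Complex.ofReal_one, one_mul] at hω
  have hX : planeCross v f = planeCross f e * (planeDot e f) + -planeCross f e * planeDot e v := by
    have : planeDot e e * planeCross v f =
        planeCross v e * planeDot e f - planeCross f e * planeDot e v := by
      simp only [planeDot, planeCross]; ring
    rw [he, one_mul, hST] at this
    rw [this]; ring
  have hval : planeDot (w - Complex.I * f) (f + v) + planeDot e (Complex.I * f + w) =
      2 * planeCross v f + planeCross f e + planeCross v e := by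
    rw [hω]
    simp [planeDot, planeCross]; ring
  have hp : planeDot (e + f) (e + f) = 2 + 2 * planeDot e f := by
    have : planeDot (e + f) (e + f) = planeDot e e + planeDot f f + 2 * planeDot e f := by
      simp [planeDot]; ring
    rw [this, he, hf]; ring
  -- The derivative is now 2 S (1 + 2 e·f) with S the determinant of f and e, while ‖e + f‖ < 1 says
  -- that e·f < -1/2.
  rw [hval, hX, hST]
  nlinarith

theorem eventually_lt_of_deriv_pos {F : ℝ → ℝ} (hc : ContinuousAt F 0)
    (h : ∀ᶠ ε in 𝓝[>] (0 : ℝ), ∃ d, 0 < d ∧ HasDerivAt F d ε) :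
    ∀ᶠ ε in 𝓝[>] (0 : ℝ), F 0 < F ε := by
  obtain ⟨u, hu, hsub⟩ := mem_nhdsGT_iff_exists_Ioo_subset.mp h
  filter_upwards [Ioo_mem_nhdsGT hu] with ε hε
  have hmono : StrictMonoOn F (Set.Icc 0 ε) := by
    apply strictMonoOn_of_deriv_pos (convex_Icc 0 ε)
    · intro s hs
      rcases eq_or_lt_of_le hs.1 with e | hs0
      · rw [← e]; exact hc.continuousWithinAt
      · obtain ⟨d, -, hd⟩ := hsub ⟨hs0, hs.2.trans_lt hε.2⟩
        exact hd.continuousAt.continuousWithinAt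
    · intro s hs
      rw [interior_Icc] at hs
      obtain ⟨d, hd0, hd⟩ := hsub ⟨hs.1, hs.2.trans hε.2⟩
      rwa [hd.deriv]
  exact hmono ⟨le_rfl, hε.1.le⟩ ⟨hε.1.le, le_rfl⟩ hε.1

theorem eventually_lt_of_deriv_neg {F : ℝ → ℝ} (hc : ContinuousAt F 0)
    (h : ∀ᶠ ε in 𝓝[<] (0 : ℝ), ∃ d, d < 0 ∧ HasDerivAt F d ε) :
    ∀ᶠ ε in 𝓝[<] (0 : ℝ), F 0 < F ε := by
  have hneg : Tendsto (fun ε : ℝ => -ε) (𝓝[>] 0) (𝓝[<] 0) := by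
    simpa using tendsto_neg_nhdsGT (a := (0 : ℝ))
  have hneg' : Tendsto (fun ε : ℝ => -ε) (𝓝[<] 0) (𝓝[>] 0) := by
    simpa using tendsto_neg_nhdsLT (a := (0 : ℝ))
  have h1 : ∀ᶠ ε in 𝓝[>] (0 : ℝ), ∃ d, 0 < d ∧ HasDerivAt (fun s => F (-s)) d ε := by
    filter_upwards [hneg.eventually h] with ε hε
    obtain ⟨d, hd0, hd⟩ := hε
    refine ⟨-d, by linarith, ?_⟩
    exact (hd.comp ε (hasDerivAt_neg ε)).congr_deriv (by ring)
  have h2 := eventually_lt_of_deriv_pos (F := fun s => F (-s))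
    (ContinuousAt.comp (by simpa using hc) continuousAt_neg) h1
  filter_upwards [hneg'.eventually h2] with ε hε
  simpa using hε

theorem eventually_neg_right_of_deriv_neg {g : ℝ → ℝ} (h0 : g 0 = 0) (hd : deriv g 0 < 0) :
    ∀ᶠ ε in 𝓝[>] (0 : ℝ), g ε < 0 := by
  have := eventually_nhdsWithin_sign_eq_of_deriv_neg hd h0
  filter_upwards [this.filter_mono nhdsWithin_le_nhds, self_mem_nhdsWithin] with ε hs hε
  have e : SignType.sign (0 - ε) = -1 := sign_neg (by simpa using hε)
  rwa [e, sign_eq_neg_one_iff] at hs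

theorem eventually_pos_left_of_deriv_neg {g : ℝ → ℝ} (h0 : g 0 = 0) (hd : deriv g 0 < 0) :
    ∀ᶠ ε in 𝓝[<] (0 : ℝ), 0 < g ε := by
  have := eventually_nhdsWithin_sign_eq_of_deriv_neg hd h0
  filter_upwards [this.filter_mono nhdsWithin_le_nhds, self_mem_nhdsWithin] with ε hs hε
  have e : SignType.sign (0 - ε) = 1 := sign_pos (by simpa using hε)
  rwa [e, sign_eq_one_iff] at hs

/-- A family of chains `a`, `x ε`, `y ε`, `b` of three unit segments with fixed ends. -/
structure IsLinkage (a b : ℂ) (x y : ℝ → ℂ) : Prop where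
  hasDerivAt_left : ∀ ε, HasDerivAt x (Complex.I * (x ε - a)) ε
  norm_left : ∀ ε, ‖x ε - a‖ = 1
  differentiableAt : ∀ᶠ ε in 𝓝 (0 : ℝ), DifferentiableAt ℝ y ε
  norm_mid : ∀ᶠ ε in 𝓝 (0 : ℝ), ‖y ε - x ε‖ = 1
  norm_right : ∀ᶠ ε in 𝓝 (0 : ℝ), ‖y ε - b‖ = 1
  cross_left : 0 < planeCross (y 0 - x 0) (a - x 0)
  cross_right : 0 < planeCross (b - y 0) (x 0 - y 0)

theorem exists_isLinkage {a b y₀ : ℂ} {τ : ℝ} (h1 : ‖y₀ - (a + unitVec τ)‖ = 1)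
    (h2 : ‖y₀ - b‖ = 1) (h3 : 0 < planeCross (y₀ - (a + unitVec τ)) (a - (a + unitVec τ)))
    (h4 : 0 < planeCross (b - y₀) (a + unitVec τ - y₀)) (h5 : ‖b - (a + unitVec τ)‖ < 2) :
    ∃ y : ℝ → ℂ, y 0 = y₀ ∧ IsLinkage a b (fun ε => a + unitVec (τ + ε)) y := by
  set x : ℝ → ℂ := fun ε => a + unitVec (τ + ε) with hx
  have hx0 : x 0 = a + unitVec τ := by simp [hx]
  have hder : ∀ ε, HasDerivAt x (Complex.I * (x ε - a)) ε := by
    intro ε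
    have := ((hasDerivAt_unitVec (τ + ε)).comp_const_add τ ε).const_add a
    simpa [hx] using this
  have hcont : ContinuousAt x 0 := (hder 0).continuousAt
  have hbx : b ≠ x 0 := by
    rintro rfl
    rw [hx0] at h4
    simp [planeCross, mul_comm] at h4
  have hev1 : ∀ᶠ ε in 𝓝 (0 : ℝ), b ≠ x ε := (hcont.eventually_ne hbx.symm).mono fun _ h => h.symm
  have hev2 : ∀ᶠ ε in 𝓝 (0 : ℝ), ‖b - x ε‖ < 2 :=
    ((continuousAt_const.sub hcont).norm).eventually_lt_const (by simpa [hx0] using h5)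
  have hy0 : linkPoint b (x 0) = y₀ := by rw [hx0]; exact linkPoint_eq h1 h2 h4
  refine ⟨fun ε => linkPoint b (x ε), hy0, hder, fun ε => by simp [hx], ?_, ?_, ?_, ?_, ?_⟩
  · filter_upwards [hev1, hev2] with ε e1 e2
    exact differentiableAt_linkPoint (hder ε).differentiableAt e1 e2
  · filter_upwards [hev1, hev2] with ε e1 e2 using (norm_linkPoint e1 e2.le).1
  · filter_upwards [hev1, hev2] with ε e1 e2 using (norm_linkPoint e1 e2.le).2
  · simp only [hy0]; rw [hx0]; exact h3
  · simp only [hy0]; rw [hx0]; exact h4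

theorem planeDot_self_of_norm {z : ℂ} (hz : ‖z‖ = 1) : planeDot z z = 1 := by
  rw [← norm_sq_eq_planeDot, hz, one_pow]

namespace IsLinkage

variable {a b : ℂ} {x y : ℝ → ℂ}

theorem continuousAt_left (h : IsLinkage a b x y) : ContinuousAt x 0 :=
  (h.hasDerivAt_left 0).continuousAt

theorem continuousAt_right (h : IsLinkage a b x y) : ContinuousAt y 0 :=
  h.differentiableAt.self_of_nhds.continuousAt

/-- The part of the area of the polygon that depends on the chain. -/
def crossSum (a b : ℂ) (x y : ℝ → ℂ) (ε : ℝ) : ℝ :=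
  planeCross a (x ε) + planeCross (x ε) (y ε) + planeCross (y ε) b

/-- The two constant lengths at the moving end `y`, differentiated. -/
theorem eventually_velocity (h : IsLinkage a b x y) : ∀ᶠ ε in 𝓝 (0 : ℝ),
    planeDot (deriv y ε) (y ε - b) = 0 ∧
    planeDot (deriv y ε - Complex.I * (x ε - a)) (y ε - x ε) = 0 := by
  filter_upwards [h.differentiableAt, h.norm_mid.eventually_nhds, h.norm_right.eventually_nhds]
    with ε hd hm hr
  have hy := hd.hasDerivAt
  constructor
  · have h1 := (hy.sub_const b).planeDot (hy.sub_const b)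
    have h2 : HasDerivAt (fun s => planeDot (y s - b) (y s - b)) 0 ε :=
      (hasDerivAt_const ε (1 : ℝ)).congr_of_eventuallyEq
        (hr.mono fun s hs => planeDot_self_of_norm hs)
    have := h1.unique h2
    rw [planeDot_comm (y ε - b)] at this
    linarith
  · have h0 := hy.sub (h.hasDerivAt_left ε)
    have h1 := h0.planeDot h0
    have h2 : HasDerivAt (fun s => planeDot ((y - x) s) ((y - x) s)) 0 ε :=
      (hasDerivAt_const ε (1 : ℝ)).congr_of_eventuallyEq
        (hm.mono fun s hs => planeDot_self_of_norm hs)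
    have := h1.unique h2
    rw [planeDot_comm ((y - x) ε)] at this
    simp only [Pi.sub_apply] at this
    linarith

theorem eventually_cross_pos (h : IsLinkage a b x y) : ∀ᶠ ε in 𝓝 (0 : ℝ),
    0 < planeCross (x ε - a) (y ε - x ε) ∧ 0 < planeCross (y ε - b) (y ε - x ε) := by
  have hx := h.continuousAt_left
  have hy := h.continuousAt_right
  have h1 := h.cross_left
  have h2 := h.cross_right
  have c1 : ContinuousAt (fun ε => planeCross (x ε - a) (y ε - x ε)) 0 :=
    (hx.sub continuousAt_const).planeCross (hy.sub hx)
  have c2 : ContinuousAt (fun ε => planeCross (y ε - b) (y ε - x ε)) 0 :=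
    (hy.sub continuousAt_const).planeCross (hy.sub hx)
  refine (c1.eventually_const_lt ?_).and (c2.eventually_const_lt ?_)
  · refine h1.trans_eq ?_
    simp only [planeCross, Complex.sub_re, Complex.sub_im]; ring
  · refine h2.trans_eq ?_
    simp only [planeCross, Complex.sub_re, Complex.sub_im]; ring

/-- Half the difference of the squares of the distances `|y ε - a|` and `|x ε - b|`. -/
def angleGap (a b : ℂ) (x y : ℝ → ℂ) (ε : ℝ) : ℝ :=
  planeDot (y ε - x ε) ((x ε - a) + (y ε - b))

theorem eventually_deriv_crossSum (h : IsLinkage a b x y) : ∀ᶠ ε in 𝓝 (0 : ℝ),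
    (angleGap a b x y ε < 0 → ∃ d, 0 < d ∧ HasDerivAt (crossSum a b x y) d ε) ∧
    (0 < angleGap a b x y ε → ∃ d, d < 0 ∧ HasDerivAt (crossSum a b x y) d ε) := by
  filter_upwards [h.differentiableAt, h.norm_mid, h.norm_right, h.eventually_velocity,
    h.eventually_cross_pos] with ε hd hm hr hvel hcr
  have hy := hd.hasDerivAt
  have hx := h.hasDerivAt_left ε
  have hF : HasDerivAt (crossSum a b x y)
      (planeCross (Complex.I * (x ε - a)) ((y ε - x ε) + (x ε - a)) +
        planeCross (deriv y ε) ((y ε - x ε) - (y ε - b))) ε := by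
    refine ((((hasDerivAt_const ε a).planeCross hx).add (hx.planeCross hy)).add
      (hy.planeCross (hasDerivAt_const ε b))).congr_deriv ?_
    simp [planeCross]; ring
  have key := linkage_area_deriv (planeDot_self_of_norm hm) (planeDot_self_of_norm (h.norm_left ε))
    (planeDot_self_of_norm hr) hcr.1 hcr.2 hvel.1 hvel.2
  exact ⟨fun hg => ⟨_, key.1 hg, hF⟩, fun hg => ⟨_, key.2 hg, hF⟩⟩

theorem hasDerivAt_angleGap (h : IsLinkage a b x y) : HasDerivAt (angleGap a b x y)
    (planeDot (deriv y 0 - Complex.I * (x 0 - a)) ((x 0 - a) + (y 0 - b)) +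
      planeDot (y 0 - x 0) (Complex.I * (x 0 - a) + deriv y 0)) 0 := by
  have hy := h.differentiableAt.self_of_nhds.hasDerivAt
  have hx := h.hasDerivAt_left 0
  exact (hy.sub hx).planeDot ((hx.sub_const a).add (hy.sub_const b))

/-- At balance the gap strictly decreases, so it is negative just after and positive just before:
the area has a strict local maximum there, never a minimum. -/
theorem deriv_angleGap_neg (h : IsLinkage a b x y) (h0 : angleGap a b x y 0 = 0)
    (hlt : ‖y 0 - a‖ < 1) : deriv (angleGap a b x y) 0 < 0 := by
  rw [h.hasDerivAt_angleGap.deriv]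
  have hcr := h.eventually_cross_pos.self_of_nhds
  have hvel := h.eventually_velocity.self_of_nhds
  refine linkage_angle_deriv (planeDot_self_of_norm h.norm_mid.self_of_nhds)
    (planeDot_self_of_norm (h.norm_left 0)) (planeDot_self_of_norm h.norm_right.self_of_nhds)
    hcr.1 hcr.2 hvel.1 hvel.2 h0 ?_
  rw [sub_add_sub_cancel, ← norm_sq_eq_planeDot]
  nlinarith [norm_nonneg (y 0 - a)]

theorem continuousAt_crossSum (h : IsLinkage a b x y) : ContinuousAt (crossSum a b x y) 0 :=
  ((continuousAt_const.planeCross h.continuousAt_left).add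
    (h.continuousAt_left.planeCross h.continuousAt_right)).add
    (h.continuousAt_right.planeCross continuousAt_const)

/-- A negative gap stays negative near 0, and a zero gap becomes negative for ε > 0; in both cases
`crossSum` has positive derivative there, so the area drops. -/
theorem eventually_crossSum_lt_right (h : IsLinkage a b x y) (h0 : angleGap a b x y 0 ≤ 0)
    (hlt : ‖y 0 - a‖ < 1) :
    ∀ᶠ ε in 𝓝[>] (0 : ℝ), crossSum a b x y 0 < crossSum a b x y ε := by
  apply eventually_lt_of_deriv_pos h.continuousAt_crossSum
  have hg : ∀ᶠ ε in 𝓝[>] (0 : ℝ), angleGap a b x y ε < 0 := by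
    rcases lt_or_eq_of_le h0 with h1 | h1
    · exact (h.hasDerivAt_angleGap.continuousAt.eventually_lt_const h1).filter_mono
        nhdsWithin_le_nhds
    · exact eventually_neg_right_of_deriv_neg h1 (h.deriv_angleGap_neg h1 hlt)
  filter_upwards [hg, h.eventually_deriv_crossSum.filter_mono nhdsWithin_le_nhds] with ε h1 h2
    using h2.1 h1

theorem eventually_crossSum_lt_left (h : IsLinkage a b x y) (h0 : 0 ≤ angleGap a b x y 0)
    (hlt : ‖y 0 - a‖ < 1) :
    ∀ᶠ ε in 𝓝[<] (0 : ℝ), crossSum a b x y 0 < crossSum a b x y ε := by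
  apply eventually_lt_of_deriv_neg h.continuousAt_crossSum
  have hg : ∀ᶠ ε in 𝓝[<] (0 : ℝ), 0 < angleGap a b x y ε := by
    rcases lt_or_eq_of_le h0 with h1 | h1
    · exact (h.hasDerivAt_angleGap.continuousAt.eventually_const_lt h1).filter_mono
        nhdsWithin_le_nhds
    · exact eventually_pos_left_of_deriv_neg h1.symm (h.deriv_angleGap_neg h1.symm hlt)
  filter_upwards [hg, h.eventually_deriv_crossSum.filter_mono nhdsWithin_le_nhds] with ε h1 h2
    using h2.2 h1

/-- Since `x` rotates counterclockwise about a, the derivative of its squared norm is twice the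
determinant of `x` and a. -/
theorem eventually_norm_left_lt (h : IsLinkage a b x y) (hc : planeCross (x 0) a < 0) :
    ∀ᶠ ε in 𝓝[>] (0 : ℝ), ‖x ε‖ < ‖x 0‖ := by
  have hx := h.hasDerivAt_left 0
  have hd := (hx.planeDot hx).sub_const (planeDot (x 0) (x 0))
  have := eventually_neg_right_of_deriv_neg (g := fun ε => planeDot (x ε) (x ε) -
    planeDot (x 0) (x 0)) (sub_self _) (by
      rw [hd.deriv]
      have e : planeDot (Complex.I * (x 0 - a)) (x 0) + planeDot (x 0) (Complex.I * (x 0 - a)) =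
          2 * planeCross (x 0) a := by
        simp [planeDot, planeCross]; ring
      rw [e]; linarith)
  filter_upwards [this] with ε hε
  rw [← norm_sq_eq_planeDot, ← norm_sq_eq_planeDot] at hε
  exact lt_of_pow_lt_pow_left₀ 2 (norm_nonneg _) (by linarith)

/-- Here `y` rotates about b in the same sense as `x` about a, because ω is a ratio of two positive
determinants; the sign condition on the determinant thus makes backward motion bring it closer to
the origin. -/
theorem eventually_norm_right_lt (h : IsLinkage a b x y) (hc : 0 < planeCross (y 0) b) :
    ∀ᶠ ε in 𝓝[<] (0 : ℝ), ‖y ε‖ < ‖y 0‖ := by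
  have hy := h.differentiableAt.self_of_nhds.hasDerivAt
  have hcr := h.eventually_cross_pos.self_of_nhds
  have hvel := h.eventually_velocity.self_of_nhds
  obtain ⟨ω, hω, hω2⟩ := linkage_velocity
    (planeDot_self_of_norm h.norm_right.self_of_nhds) hvel.1 hvel.2
  have hωpos : 0 < ω := pos_of_mul_pos_left (by rw [hω2]; exact hcr.1) hcr.2.le
  have hd := (hy.planeDot hy).const_sub (planeDot (y 0) (y 0))
  have := eventually_pos_left_of_deriv_neg (g := fun ε => planeDot (y 0) (y 0) -
    planeDot (y ε) (y ε)) (sub_self _) (by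
      rw [hd.deriv, hω]
      have e : planeDot (ω * (Complex.I * (y 0 - b))) (y 0) +
          planeDot (y 0) (ω * (Complex.I * (y 0 - b))) = 2 * (ω * planeCross (y 0) b) := by
        simp [planeDot, planeCross]; ring
      rw [e]
      have := mul_pos hωpos hc
      linarith)
  filter_upwards [this] with ε hε
  rw [← norm_sq_eq_planeDot, ← norm_sq_eq_planeDot] at hε
  exact lt_of_pow_lt_pow_left₀ 2 (norm_nonneg _) (by linarith)

end IsLinkage

/-! ### Blaschke deformations as linkages -/

theorem natCast_zmod_ne_zero {n m : ℕ} (h0 : 0 < m) (h1 : m < n) : (m : ZMod n) ≠ 0 := by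
  rw [Ne, ZMod.natCast_eq_zero_iff]
  exact fun h => absurd (Nat.le_of_dvd h0 h) (not_le.mpr h1)

namespace ReuleauxPolygon

variable {N : ℕ} {r : ℝ}

theorem planeCross_vertex_pos (Q : ReuleauxPolygon N) (k : ZMod (2 * N + 1)) :
    0 < planeCross (Q.vertex (k + 1) - Q.vertex k) (Q.vertex (k - 1) - Q.vertex k) := by
  rw [Q.vertex_succ, Q.vertex_pred, add_sub_cancel_left, add_sub_cancel_left, planeCross_unitVec]
  exact Real.sin_pos_of_pos_of_lt_pi (by linarith [Q.α_lt_β k])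
    (by linarith [Q.isUnitStar.lt_add_pi k])

theorem norm_vertex_succ_sub (Q : ReuleauxPolygon N) (k : ZMod (2 * N + 1)) :
    ‖Q.vertex (k + 1) - Q.vertex k‖ = 1 := by
  rw [Q.vertex_succ, add_sub_cancel_left, norm_unitVec]

theorem vertex_eq_add (Q : ReuleauxPolygon N) (k : ZMod (2 * N + 1)) :
    Q.vertex k = Q.vertex (k - 1) + unitVec (Q.α (k - 1)) := by
  rw [← Q.vertex_succ, sub_add_cancel]

/-- The positions of the vertex `P k` under the Blaschke deformations acting on it. -/
noncomputable def movedVertex (Q : ReuleauxPolygon N) (k : ZMod (2 * N + 1)) (ε : ℝ) : ℂ :=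
  Q.vertex (k - 1) + unitVec (Q.α (k - 1) + ε)

theorem movedVertex_zero (Q : ReuleauxPolygon N) (k : ZMod (2 * N + 1)) :
    Q.movedVertex k 0 = Q.vertex k := by
  rw [movedVertex, add_zero, ← vertex_eq_add]

theorem exists_linkage (Q : ReuleauxPolygon N) (k : ZMod (2 * N + 1)) :
    ∃ y : ℝ → ℂ, y 0 = Q.vertex (k + 1) ∧
      IsLinkage (Q.vertex (k - 1)) (Q.vertex (k + 2)) (Q.movedVertex k) y := by
  have e2 : k + 2 = k + 1 + 1 := by ring
  have h4 := Q.planeCross_vertex_pos (k + 1)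
  rw [add_sub_cancel_right, ← e2] at h4
  apply exists_isLinkage
  · rw [← vertex_eq_add]; exact Q.norm_vertex_succ_sub k
  · rw [norm_sub_rev, e2]; exact Q.norm_vertex_succ_sub (k + 1)
  · rw [← vertex_eq_add]; exact Q.planeCross_vertex_pos k
  · rw [← vertex_eq_add]; exact h4
  · rw [← vertex_eq_add]; exact (Q.isUnitStar.norm_sub_le _ _).trans_lt one_lt_two

/-- The vertices with `P k` and `P (k + 1)` replaced by `p` and `q`. -/
def replaceVertices (Q : ReuleauxPolygon N) (k : ZMod (2 * N + 1)) (p q : ℂ) :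
    ZMod (2 * N + 1) → ℂ :=
  fun j => if j = k then p else if j = k + 1 then q else Q.vertex j

section Replace

variable (Q : ReuleauxPolygon N) (k : ZMod (2 * N + 1)) (p q : ℂ)

theorem replaceVertices_self : Q.replaceVertices k p q k = p := by simp [replaceVertices]

theorem replaceVertices_succ (hN : 2 ≤ N) : Q.replaceVertices k p q (k + 1) = q := by
  have : (1 : ZMod (2 * N + 1)) ≠ 0 := by
    exact_mod_cast natCast_zmod_ne_zero one_pos (by omega : 1 < 2 * N + 1)
  simp [replaceVertices, this]

theorem replaceVertices_of_ne {j : ZMod (2 * N + 1)} (h1 : j ≠ k) (h2 : j ≠ k + 1) :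
    Q.replaceVertices k p q j = Q.vertex j := by
  simp [replaceVertices, h1, h2]

theorem replaceVertices_vertex : Q.replaceVertices k (Q.vertex k) (Q.vertex (k + 1)) = Q.vertex := by
  ext1 j
  unfold replaceVertices
  split_ifs with h1 h2
  · rw [h1]
  · rw [h2]
  · rfl

variable {k}

theorem pred_ne (hN : 2 ≤ N) : k - 1 ≠ k ∧ k - 1 ≠ k + 1 := by
  have h1 : (1 : ZMod (2 * N + 1)) ≠ 0 := by
    exact_mod_cast natCast_zmod_ne_zero one_pos (by omega : 1 < 2 * N + 1)
  have h2 : (2 : ZMod (2 * N + 1)) ≠ 0 := by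
    exact_mod_cast natCast_zmod_ne_zero two_pos (by omega : 2 < 2 * N + 1)
  exact ⟨fun h => h1 (by linear_combination -h), fun h => h2 (by linear_combination -h)⟩

theorem add_two_ne (hN : 2 ≤ N) : k + 2 ≠ k ∧ k + 2 ≠ k + 1 := by
  have h1 : (1 : ZMod (2 * N + 1)) ≠ 0 := by
    exact_mod_cast natCast_zmod_ne_zero one_pos (by omega : 1 < 2 * N + 1)
  have h2 : (2 : ZMod (2 * N + 1)) ≠ 0 := by
    exact_mod_cast natCast_zmod_ne_zero two_pos (by omega : 2 < 2 * N + 1)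
  exact ⟨fun h => h2 (by linear_combination h), fun h => h1 (by linear_combination h)⟩

/-- Only the edges that start at the labels k - 1, k and k + 1 change; N ≥ 2 makes the four labels
from k - 1 to k + 2 distinct. -/
theorem sum_planeCross_replaceVertices (hN : 2 ≤ N) :
    ∑ j, planeCross (Q.replaceVertices k p q j) (Q.replaceVertices k p q (j + 1)) -
      ∑ j, planeCross (Q.vertex j) (Q.vertex (j + 1)) =
    (planeCross (Q.vertex (k - 1)) p + planeCross p q + planeCross q (Q.vertex (k + 2))) -
    (planeCross (Q.vertex (k - 1)) (Q.vertex k) + planeCross (Q.vertex k) (Q.vertex (k + 1)) +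
      planeCross (Q.vertex (k + 1)) (Q.vertex (k + 2))) := by
  have h1 : (1 : ZMod (2 * N + 1)) ≠ 0 := by
    exact_mod_cast natCast_zmod_ne_zero one_pos (by omega : 1 < 2 * N + 1)
  have hp := pred_ne (k := k) hN
  have ht := add_two_ne (k := k) hN
  have e2 : k + 1 + 1 = k + 2 := by ring
  rw [← Finset.sum_sub_distrib, ← Finset.sum_subset (Finset.subset_univ {k - 1, k, k + 1})]
  · rw [Finset.sum_insert (by simp [hp.1, hp.2]), Finset.sum_insert (by simp [h1]),
      Finset.sum_singleton, sub_add_cancel, e2, replaceVertices_self, replaceVertices_succ _ _ _ _ hN,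
      replaceVertices_of_ne _ _ _ _ hp.1 hp.2, replaceVertices_of_ne _ _ _ _ ht.1 ht.2]
    ring
  · intro j _ hj
    simp only [Finset.mem_insert, Finset.mem_singleton, not_or] at hj
    rw [replaceVertices_of_ne _ _ _ _ hj.2.1 hj.2.2, replaceVertices_of_ne, sub_self]
    · exact fun h => hj.1 (by rw [← h]; ring)
    · exact fun h => hj.2.1 (by linear_combination h)

theorem replaceVertices_link (hN : 2 ≤ N) (h1 : ‖p - Q.vertex (k - 1)‖ = 1) (h2 : ‖q - p‖ = 1)
    (h3 : ‖q - Q.vertex (k + 2)‖ = 1) (j : ZMod (2 * N + 1)) :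
    ‖Q.replaceVertices k p q (j + 1) - Q.replaceVertices k p q j‖ = 1 := by
  have hp := pred_ne (k := k) hN
  have ht := add_two_ne (k := k) hN
  have e2 : k + 1 + 1 = k + 2 := by ring
  by_cases hj : j = k
  · rw [hj, replaceVertices_self, replaceVertices_succ _ _ _ _ hN, h2]
  by_cases hj1 : j = k + 1
  · rw [hj1, e2, replaceVertices_succ _ _ _ _ hN, replaceVertices_of_ne _ _ _ _ ht.1 ht.2,
      norm_sub_rev, h3]
  by_cases hj2 : j = k - 1
  · rw [hj2, sub_add_cancel, replaceVertices_self, replaceVertices_of_ne _ _ _ _ hp.1 hp.2, h1]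
  · rw [replaceVertices_of_ne _ _ _ _ hj hj1, replaceVertices_of_ne, Q.norm_vertex_succ_sub]
    · exact fun h => hj2 (by rw [← h]; ring)
    · exact fun h => hj (by linear_combination h)

end Replace

theorem continuousAt_replaceVertices (Q : ReuleauxPolygon N) (k : ZMod (2 * N + 1)) {x y : ℝ → ℂ}
    (hx : ContinuousAt x 0) (hy : ContinuousAt y 0) (j : ZMod (2 * N + 1)) :
    ContinuousAt (fun ε => Q.replaceVertices k (x ε) (y ε) j) 0 := by
  unfold replaceVertices
  split_ifs
  · exact hx
  · exact hy
  · exact continuousAt_const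

/-- Small changes of two consecutive vertices that preserve the unit distances give Reuleaux
polygons, as long as the vertices stay in the outer disk. -/
theorem eventually_exists_polygon (Q : ReuleauxPolygon N) (hN : 2 ≤ N) (hr : 0 < r)
    {k : ZMod (2 * N + 1)}
    {y : ℝ → ℂ} (hy0 : y 0 = Q.vertex (k + 1))
    (hy : IsLinkage (Q.vertex (k - 1)) (Q.vertex (k + 2)) (Q.movedVertex k) y) :
    ∀ᶠ ε in 𝓝 (0 : ℝ), (∀ j, ‖Q.replaceVertices k (Q.movedVertex k ε) (y ε) j‖ ≤ 1 - r) →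
      ∃ Q' : ReuleauxPolygon N, Q'.vertex = Q.replaceVertices k (Q.movedVertex k ε) (y ε) := by
  set V : ℝ → ZMod (2 * N + 1) → ℂ := fun ε => Q.replaceVertices k (Q.movedVertex k ε) (y ε) with hV
  have hV0 : V 0 = Q.vertex := by
    simp only [hV, movedVertex_zero, hy0, replaceVertices_vertex]
  have hc : ∀ j, ContinuousAt (fun ε => V ε j) 0 :=
    Q.continuousAt_replaceVertices k hy.continuousAt_left hy.continuousAt_right
  have hlink : ∀ᶠ ε in 𝓝 (0 : ℝ), ∀ j, ‖V ε (j + 1) - V ε j‖ = 1 := by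
    filter_upwards [hy.norm_mid, hy.norm_right] with ε h1 h2
    exact Q.replaceVertices_link _ _ hN (hy.norm_left ε) h1 h2
  have hinj : ∀ᶠ ε in 𝓝 (0 : ℝ), ∀ i j, i ≠ j → V ε i ≠ V ε j := by
    simp only [eventually_all]
    intro i j hij
    exact ((hc i).ne_iff_eventually_ne (hc j)).mp (by rw [hV0]; exact Q.vertex_injective.ne hij)
  -- Nonadjacent vertices are at distance strictly less than 1, an open condition; adjacent ones are
  -- held at distance 1 by the linkage.
  have hdist : ∀ᶠ ε in 𝓝 (0 : ℝ), ∀ i j, i ≠ j + 1 → j ≠ i + 1 → ‖V ε i - V ε j‖ < 1 := by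
    simp only [eventually_all]
    intro i j h1 h2
    refine ((hc i).sub (hc j)).norm.eventually_lt_const ?_
    simpa [hV0] using Q.norm_vertex_sub_lt_one h1 h2
  have hcross : ∀ᶠ ε in 𝓝 (0 : ℝ), ∀ j,
      0 < planeCross (V ε (j + 1) - V ε j) (V ε (j - 1) - V ε j) := by
    rw [eventually_all]
    intro j
    refine (((hc (j + 1)).sub (hc j)).planeCross
      ((hc (j - 1)).sub (hc j))).eventually_const_lt ?_
    simpa [hV0] using Q.planeCross_vertex_pos j
  filter_upwards [hlink, hinj, hdist, hcross] with ε h1 h2 h3 h4 h5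
  refine exists_of_vertices (fun i j h => not_not.mp fun hij => h2 i j hij h) h1 (fun i j => ?_) h4
    hr h5
  by_cases e1 : i = j + 1
  · rw [e1]; exact (h1 j).le
  by_cases e2 : j = i + 1
  · rw [e2, norm_sub_rev]; exact (h1 i).le
  · exact (h3 i j e1 e2).le

/-- A polygon is not rigid if a family of admissible deformations decreases its area. -/
theorem not_isRigid (Q : ReuleauxPolygon N) (hr : HasCentredIncircle Q.body r) (hN : 2 ≤ N)
    {k : ZMod (2 * N + 1)} {y : ℝ → ℂ} (hy0 : y 0 = Q.vertex (k + 1))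
    (hy : IsLinkage (Q.vertex (k - 1)) (Q.vertex (k + 2)) (Q.movedVertex k) y)
    {l : Filter ℝ} [l.NeBot] (hl : l ≤ 𝓝 0) (hx1 : ∀ᶠ ε in l, ‖Q.movedVertex k ε‖ ≤ 1 - r)
    (hy1 : ∀ᶠ ε in l, ‖y ε‖ ≤ 1 - r)
    (harea : ∀ᶠ ε in l,
      IsLinkage.crossSum (Q.vertex (k - 1)) (Q.vertex (k + 2)) (Q.movedVertex k) y 0 <
      IsLinkage.crossSum (Q.vertex (k - 1)) (Q.vertex (k + 2)) (Q.movedVertex k) y ε)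
    (h0 : (0 : ℂ) ∈ convexHull ℝ
      (Q.vertex '' {j | ‖Q.vertex j‖ = 1 - r ∧ j ≠ k ∧ j ≠ k + 1})) : ¬ Q.IsRigid r := by
  rintro ⟨δ, hδ, hrig⟩
  have hpos := Q.inradius_pos hr.1
  have hsmall : ∀ᶠ ε in 𝓝 (0 : ℝ), |ε| < δ := by
    have : ContinuousAt (fun ε : ℝ => |ε|) 0 := continuous_abs.continuousAt
    exact this.eventually_lt_const (by simpa using hδ)
  obtain ⟨ε, h1, h2, h3, h4, h5⟩ := (((hsmall.filter_mono hl).and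
    (((Q.eventually_exists_polygon hN hpos hy0 hy).filter_mono hl).and
      (hx1.and (hy1.and harea))))).exists
  have hV : ∀ j, ‖Q.replaceVertices k (Q.movedVertex k ε) (y ε) j‖ ≤ 1 - r := by
    intro j
    unfold replaceVertices
    split_ifs
    · exact h3
    · exact h4
    · exact Q.norm_vertex_le hr j
  obtain ⟨Q', hQ'⟩ := h2 hV
  have hr' : HasCentredIncircle Q'.body r := by
    rw [Q'.body_eq, hQ']
    -- The outer vertices that do not move already surround the origin, so the incircle survives
    -- wherever the moved ones go in the outer disk.
    refine hasCentredIncircle_diskInter hpos hV ?_ h0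
    rintro _ ⟨j, ⟨hj1, hj2, hj3⟩, rfl⟩
    exact ⟨⟨j, replaceVertices_of_ne _ _ _ _ hj2 hj3⟩, hj1⟩
  refine hrig k ε Q' h1 ⟨?_, fun j hj1 hj2 => ?_⟩ hr' ?_
  · rw [hQ', replaceVertices_self, movedVertex]
  · rw [hQ', replaceVertices_of_ne _ _ _ _ hj1 hj2]
  · have hvol := Q.volume_body hr
    have hQpos : 0 < volume Q.body :=
      (isOpen_interior.measure_pos volume Q.constantWidth.interior_nonempty).trans_le
        (measure_mono interior_subset)
    rw [hvol, ENNReal.ofReal_pos] at hQpos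
    rw [hvol, Q'.volume_body hr', ENNReal.ofReal_lt_ofReal_iff hQpos, hQ']
    have := Q.sum_planeCross_replaceVertices (k := k) (Q.movedVertex k ε) (y ε) hN
    simp only [IsLinkage.crossSum, movedVertex_zero, hy0] at h5
    linarith

end ReuleauxPolygon

/-! ### Angles and cones at the outer circle -/

/-- In a triangle with a vertex at the origin the larger angle is opposite to the larger side: `w` is
the apex of an isosceles triangle with unit legs whose base is a chord of the circle of radius
`R`. -/
theorem cos_half_lt {w : ℂ} {a b c R : ℝ} (hab : a < b) (hpi : b < a + Real.pi)
    (ha : ‖w + unitVec a‖ = R) (hb : ‖w + unitVec b‖ = R) (hw0 : 0 < ‖w‖) (hw : ‖w‖ < R) (hR : R < 1)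
    (hw1 : 1 < R + ‖w‖) (hc : 2 * R * c = R ^ 2 + 1 - ‖w‖ ^ 2) :
    Real.cos ((b - a) / 2) < c := by
  have expand : ∀ s, ‖w + unitVec s‖ ^ 2 = ‖w‖ ^ 2 + 1 + 2 * planeDot (unitVec s) w := by
    intro s
    rw [norm_sq_eq_planeDot, norm_sq_eq_planeDot, ← planeDot_unitVec_self s]
    simp only [planeDot, Complex.add_re, Complex.add_im]; ring
  have h1 := expand a
  have h2 := expand b
  rw [ha] at h1
  rw [hb] at h2
  set m := (a + b) / 2 with hm
  set η := (b - a) / 2 with hη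
  have ea : a = m - η := by rw [hm, hη]; ring
  have eb : b = m + η := by rw [hm, hη]; ring
  have hsin : 0 < Real.sin η := Real.sin_pos_of_pos_of_lt_pi (by linarith) (by linarith)
  have hcos : 0 < Real.cos η := Real.cos_pos_of_mem_Ioo ⟨by linarith, by linarith⟩
  have h3 : planeDot (unitVec a) w = Real.cos η * planeDot (unitVec m) w +
      Real.sin η * (w.re * Real.sin m - w.im * Real.cos m) := by
    rw [ea]; simp only [planeDot, unitVec_re, unitVec_im, Real.cos_sub, Real.sin_sub]; ring
  have h4 : planeDot (unitVec b) w = Real.cos η * planeDot (unitVec m) w -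
      Real.sin η * (w.re * Real.sin m - w.im * Real.cos m) := by
    rw [eb]; simp only [planeDot, unitVec_re, unitVec_im, Real.cos_add, Real.sin_add]; ring
  have h5 : w.re * Real.sin m - w.im * Real.cos m = 0 := by
    have : Real.sin η * (w.re * Real.sin m - w.im * Real.cos m) = 0 := by linarith
    exact (mul_eq_zero.mp this).resolve_left hsin.ne'
  have h6 : planeDot (unitVec m) w ^ 2 = ‖w‖ ^ 2 := by
    have : planeDot (unitVec m) w ^ 2 + (w.re * Real.sin m - w.im * Real.cos m) ^ 2 = ‖w‖ ^ 2 := by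
      rw [norm_sq_eq_planeDot]
      simp only [planeDot, unitVec_re, unitVec_im]
      linear_combination (w.re ^ 2 + w.im ^ 2) * Real.sin_sq_add_cos_sq m
    rw [h5] at this; linarith
  have h7 : 2 * (Real.cos η * planeDot (unitVec m) w) = R ^ 2 - ‖w‖ ^ 2 - 1 := by
    rw [h5] at h3; linarith
  -- The origin is on the axis of the isosceles triangle, on the side of the base as seen from w:
  -- the other sign would make the left side of `h7` positive, but R < 1.
  have h8 : planeDot (unitVec m) w = -‖w‖ := by
    rcases sq_eq_sq_iff_eq_or_eq_neg.mp h6 with h | h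
    · rw [h] at h7
      have := mul_pos hcos hw0
      nlinarith
    · exact h
  rw [h8] at h7
  -- This product is the difference of the two sides once the cosines are written by the law of
  -- cosines.
  have h9 : 0 < (R - ‖w‖) * ((R + ‖w‖) ^ 2 - 1) :=
    mul_pos (by linarith) (by nlinarith)
  have h10 : 2 * R * ‖w‖ * Real.cos η < 2 * R * ‖w‖ * c := by
    have e1 : 2 * R * ‖w‖ * Real.cos η = R * (1 + ‖w‖ ^ 2 - R ^ 2) := by linear_combination -R * h7
    have e2 : 2 * R * ‖w‖ * c = ‖w‖ * (R ^ 2 + 1 - ‖w‖ ^ 2) := by linear_combination ‖w‖ * hc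
    rw [e1, e2]
    nlinarith
  have hR0 : 0 < R := hw0.trans hw
  exact lt_of_mul_lt_mul_left h10 (by positivity)

theorem eventually_norm_le {f : ℝ → ℂ} {R : ℝ} (hf : ContinuousAt f 0) (h : ‖f 0‖ < R) :
    ∀ᶠ ε in 𝓝 (0 : ℝ), ‖f ε‖ ≤ R :=
  (hf.norm.eventually_lt_const h).mono fun _ h => h.le

namespace ReuleauxPolygon

variable {N : ℕ} {r : ℝ}

theorem norm_sq_add_unitVec (R t s : ℝ) :
    ‖-((R : ℂ) * unitVec t) + unitVec s‖ ^ 2 = R ^ 2 + 1 - 2 * R * Real.cos (t - s) := by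
  have h1 := Real.sin_sq_add_cos_sq t
  have h2 := Real.sin_sq_add_cos_sq s
  rw [norm_sq_eq_planeDot, Real.cos_sub]
  simp [planeDot]
  linear_combination R ^ 2 * h1 + h2

/-- The arc of a vertex on the outer circle between two vertices that are not on it is shorter than
one of the neighbouring arcs. -/
theorem angle_lt_or_angle_lt (Q : ReuleauxPolygon N) (hr : HasCentredIncircle Q.body r)
    {k : ZMod (2 * N + 1)} (hk : ‖Q.vertex k‖ = 1 - r) (h1 : ‖Q.vertex (k + 1)‖ ≠ 1 - r)
    (h2 : ‖Q.vertex (k + 2)‖ = 1 - r) (h3 : ‖Q.vertex (k - 1)‖ ≠ 1 - r)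
    (h4 : ‖Q.vertex (k - 2)‖ = 1 - r) :
    Q.β k - Q.α k < Q.β (k + 1) - Q.α (k + 1) ∨ Q.β k - Q.α k < Q.β (k - 1) - Q.α (k - 1) := by
  have hpos := Q.inradius_pos hr.1
  have hS := Q.isUnitStar
  obtain ⟨t, ht, e⟩ := Q.exists_tangent hr hk
  -- In the triangle with vertices 0, P k, P j the angle at P k is |t - s| and the angle at P j is
  -- half that of Γ j; the latter is opposite to the larger side. The tangent direction t splits Γ k
  -- in two parts, one to compare with each neighbour.
  have key : ∀ (j : ZMod (2 * N + 1)) (s : ℝ), ‖Q.vertex j‖ ≠ 1 - r →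
      ‖Q.vertex (j + 1)‖ = 1 - r → ‖Q.vertex (j - 1)‖ = 1 - r →
      Q.vertex j = Q.vertex k + unitVec s → |t - s| ≤ Real.pi →
      |t - s| < (Q.β j - Q.α j) / 2 := by
    intro j s hj hj1 hj2 hjs hts
    have hlt := lt_of_le_of_ne (Q.norm_vertex_le hr j) hj
    have hgt := Q.lt_norm_vertex hr j
    have hcos : Real.cos ((Q.β j - Q.α j) / 2) < Real.cos (t - s) := by
      refine cos_half_lt (Q.α_lt_β j) (hS.lt_add_pi j) (w := Q.vertex j) (R := 1 - r)
        (by rw [← Q.vertex_succ, hj1]) (by rw [← Q.vertex_pred, hj2]) (hpos.trans hgt) hlt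
        (by linarith) (by linarith) ?_
      rw [hjs, e, norm_sq_add_unitVec]; ring
    by_contra hcon
    push Not at hcon
    have := Real.cos_le_cos_of_nonneg_of_le_pi (by linarith [Q.α_lt_β j]) hts hcon
    rw [Real.cos_abs] at this
    linarith
  have hpi := hS.lt_add_pi k
  have hp := key (k + 1) (Q.α k) h1 (by rw [add_assoc, one_add_one_eq_two, h2])
    (by rw [add_sub_cancel_right, hk]) (Q.vertex_succ k)
    (by rw [abs_of_pos (by linarith [ht.1])]; linarith [ht.2])
  have hm := key (k - 1) (Q.β k) h3 (by rw [sub_add_cancel, hk])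
    (by rw [sub_sub, one_add_one_eq_two, h4]) (Q.vertex_pred k)
    (by rw [abs_of_neg (by linarith [ht.2])]; linarith [ht.1])
  rw [abs_of_pos (by linarith [ht.1])] at hp
  rw [abs_of_neg (by linarith [ht.2])] at hm
  by_contra hcon
  push Not at hcon
  linarith [hcon.1, hcon.2]

/-- Of three vertices on the outer circle that follow each other on the boundary, the middle one is in
the cone of the other two. -/
theorem exists_cone_combination (Q : ReuleauxPolygon N) (hr : HasCentredIncircle Q.body r)
    (hN : 2 ≤ N) {k : ZMod (2 * N + 1)} (hk : ‖Q.vertex k‖ = 1 - r)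
    (h2 : ‖Q.vertex (k + 2)‖ = 1 - r) (h4 : ‖Q.vertex (k - 2)‖ = 1 - r) :
    ∃ c d : ℝ, 0 < c ∧ 0 < d ∧ Q.vertex k = c * Q.vertex (k + 2) + d * Q.vertex (k - 2) := by
  have hS := Q.isUnitStar
  obtain ⟨t₀, ht₀, e₀⟩ := Q.exists_tangent hr h4
  obtain ⟨t₂, ht₂, e₂⟩ := Q.exists_tangent hr hk
  obtain ⟨t₄, ht₄, e₄⟩ := Q.exists_tangent hr h2
  have i2 : k - 2 + (2 : ℕ) = k := by push_cast; ring
  have i4 : k - 2 + (4 : ℕ) = k + 2 := by push_cast; ring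
  have s2 := hS.unitVec_sweep (k - 2) 2 (Q.β k - t₂)
  have s4 := hS.unitVec_sweep (k - 2) 4 (Q.β (k + 2) - t₄)
  have w1 := IsUnitStar.sweep_succ (α := Q.α) (β := Q.β) (k - 2) 0
  have w3 := IsUnitStar.sweep_succ (α := Q.α) (β := Q.β) (k - 2) 2
  have w5 := IsUnitStar.sweep_succ (α := Q.α) (β := Q.β) (k - 2) 4
  rw [IsUnitStar.sweep_zero, Nat.cast_zero, add_zero] at w1
  rw [i2] at w3 s2
  rw [i4] at w5 s4
  rw [sub_sub_cancel, show (-1 : ℂ) ^ 2 = 1 by norm_num, one_mul] at s2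
  rw [sub_sub_cancel, show (-1 : ℂ) ^ 4 = 1 by norm_num, one_mul] at s4
  -- Γ (k - 1) and Γ (k + 1) separate the three tangent directions strictly, and the five arcs
  -- together sweep at most π. The even powers of -1 leave the directions unreversed.
  have m1 := (hS.sweep_mono (k - 2)) (show 1 < 2 by norm_num)
  have m3 := (hS.sweep_mono (k - 2)) (show 3 < 4 by norm_num)
  have m5 := (hS.sweep_mono (k - 2)).monotone (show 5 ≤ 2 * N + 1 by omega)
  rw [hS.sweep_eq_pi Q.vertex_injective] at m5
  norm_num at w1 w3 w5
  set φ₂ := Q.β (k - 2) - IsUnitStar.sweep Q.α Q.β (k - 2) 2 - (Q.β k - t₂) with hφ₂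
  set φ₄ := Q.β (k - 2) - IsUnitStar.sweep Q.α Q.β (k - 2) 4 - (Q.β (k + 2) - t₄) with hφ₄
  have d1 : φ₂ < t₀ := by linarith [ht₀.1, ht₂.2]
  have d2 : φ₄ < φ₂ := by linarith [ht₂.1, ht₄.2]
  have d3 : t₀ - φ₄ < Real.pi := by linarith [ht₀.2, ht₄.1]
  have p1 : 0 < Real.sin (t₀ - φ₄) := Real.sin_pos_of_pos_of_lt_pi (by linarith) d3
  have p2 : 0 < Real.sin (t₀ - φ₂) := Real.sin_pos_of_pos_of_lt_pi (by linarith) (by linarith)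
  have p3 : 0 < Real.sin (φ₂ - φ₄) := Real.sin_pos_of_pos_of_lt_pi (by linarith) (by linarith)
  have hcomb := sin_mul_unitVec φ₄ t₀ φ₂
  rw [s2, s4] at hcomb
  refine ⟨_, _, div_pos p2 p1, div_pos p3 p1, ?_⟩
  have p1' : (Real.sin (t₀ - φ₄) : ℂ) ≠ 0 := by exact_mod_cast p1.ne'
  rw [e₀, e₂, e₄, Complex.ofReal_div, Complex.ofReal_div]
  field_simp
  linear_combination (-((1 - r : ℝ) : ℂ)) * hcomb

/-- An open half-plane bounded by a line through the origin that contains the other outer vertices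
contains P (k - 2) and P (k + 2), hence also P k, a positive combination of them. -/
theorem zero_mem_convexHull_diff (Q : ReuleauxPolygon N) (hr : HasCentredIncircle Q.body r)
    (hN : 2 ≤ N) {k : ZMod (2 * N + 1)} (hk : ‖Q.vertex k‖ = 1 - r)
    (h2 : ‖Q.vertex (k + 2)‖ = 1 - r) (h4 : ‖Q.vertex (k - 2)‖ = 1 - r) :
    (0 : ℂ) ∈ convexHull ℝ (Q.vertex '' {j | ‖Q.vertex j‖ = 1 - r ∧ j ≠ k}) := by
  by_contra hcon
  obtain ⟨v, hv⟩ := exists_planeDot_pos ((Set.toFinite _).image Q.vertex) hcon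
  obtain ⟨c, d, hc, hd, e⟩ := Q.exists_cone_combination hr hN hk h2 h4
  have two_ne : (2 : ZMod (2 * N + 1)) ≠ 0 := by
    exact_mod_cast natCast_zmod_ne_zero two_pos (by omega : 2 < 2 * N + 1)
  obtain ⟨_, ⟨j, hj, rfl⟩, hle⟩ := exists_planeDot_nonpos (Q.zero_mem_convexHull hr) v
  by_cases hjk : j = k
  · rw [hjk, e, planeDot_add_right, planeDot_smul_right, planeDot_smul_right] at hle
    have v1 := hv _ ⟨k + 2, ⟨h2, fun h => two_ne (by linear_combination h)⟩, rfl⟩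
    have v2 := hv _ ⟨k - 2, ⟨h4, fun h => two_ne (by linear_combination -h)⟩, rfl⟩
    have := mul_pos hc v1
    have := mul_pos hd v2
    linarith
  · exact absurd (hv _ ⟨j, ⟨hj, hjk⟩, rfl⟩) (not_lt.mpr hle)

/-- The ray from P k through the origin runs strictly between the two edges at P k, since the
tangent direction is interior to the arc. These signs tell which rotation pulls P k inwards. -/
theorem planeCross_succ_pos (Q : ReuleauxPolygon N) (hr : HasCentredIncircle Q.body r)
    {k : ZMod (2 * N + 1)} (hk : ‖Q.vertex k‖ = 1 - r) :
    0 < planeCross (Q.vertex k) (Q.vertex (k + 1)) ∧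
      planeCross (Q.vertex k) (Q.vertex (k - 1)) < 0 := by
  have hR : 0 < 1 - r := by linarith [Q.lt_norm_vertex hr k, Q.inradius_pos hr.1]
  have hpi := Q.isUnitStar.lt_add_pi k
  obtain ⟨t, ht, e⟩ := Q.exists_tangent hr hk
  have key : ∀ s, planeCross (Q.vertex k) (Q.vertex k + unitVec s) =
      (1 - r) * Real.sin (t - s) := by
    intro s
    have : planeCross (Q.vertex k) (Q.vertex k + unitVec s) = planeCross (Q.vertex k) (unitVec s) := by
      simp only [planeCross, Complex.add_re, Complex.add_im]; ring
    rw [this, e, Real.sin_sub]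
    simp only [planeCross, Complex.neg_re, Complex.neg_im, Complex.re_ofReal_mul,
      Complex.im_ofReal_mul, unitVec_re, unitVec_im]
    ring
  rw [Q.vertex_succ, Q.vertex_pred, key, key]
  constructor
  · exact mul_pos hR (Real.sin_pos_of_pos_of_lt_pi (by linarith [ht.1]) (by linarith [ht.2]))
  · exact mul_neg_of_pos_of_neg hR
      (Real.sin_neg_of_neg_of_neg_pi_lt (by linarith [ht.2]) (by linarith [ht.1]))

/-- The middle bar makes the angles of Γ k and Γ (k + 1) with the outer bars; so the balance of the
linkage is a comparison of arc widths. -/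
theorem angleGap_eq (Q : ReuleauxPolygon N) {k : ZMod (2 * N + 1)} {y : ℝ → ℂ}
    (hy0 : y 0 = Q.vertex (k + 1)) :
    IsLinkage.angleGap (Q.vertex (k - 1)) (Q.vertex (k + 2)) (Q.movedVertex k) y 0 =
      Real.cos (Q.β (k + 1) - Q.α (k + 1)) - Real.cos (Q.β k - Q.α k) := by
  have e1 : Q.vertex (k + 1) - Q.vertex k = unitVec (Q.α k) := by rw [Q.vertex_succ]; ring
  have e2 : Q.vertex k - Q.vertex (k - 1) = -unitVec (Q.β k) := by rw [Q.vertex_pred]; ring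
  have e3 : Q.vertex (k + 1) - Q.vertex (k + 2) = -unitVec (Q.α (k + 1)) := by
    rw [show k + 2 = k + 1 + 1 by ring, Q.vertex_succ (k + 1)]; ring
  have e4 : unitVec (Q.α k) = -unitVec (Q.β (k + 1)) := by
    rw [Q.isUnitStar.unitVec_β_succ, neg_neg]
  rw [IsLinkage.angleGap, movedVertex_zero, hy0, planeDot_add_right, e1, e2, e3, ← planeDot_unitVec,
    ← planeDot_unitVec]
  have neg_right : ∀ z w, planeDot z (-w) = -planeDot z w := fun z w => by
    rw [planeDot_comm, planeDot_neg_left, planeDot_comm]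
  rw [neg_right, neg_right, planeDot_comm (unitVec (Q.β k))]
  nth_rw 2 [e4]
  rw [planeDot_neg_left]; ring

/-- The bound under which the linkage lemmas apply. It fails for a triangle, where these two
vertices are adjacent. -/
theorem norm_vertex_succ_sub_pred_lt (Q : ReuleauxPolygon N) (hN : 2 ≤ N) (k : ZMod (2 * N + 1)) :
    ‖Q.vertex (k + 1) - Q.vertex (k - 1)‖ < 1 := by
  have h1 : (1 : ZMod (2 * N + 1)) ≠ 0 := by
    exact_mod_cast natCast_zmod_ne_zero one_pos (by omega : 1 < 2 * N + 1)
  have h3 : (3 : ZMod (2 * N + 1)) ≠ 0 := by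
    exact_mod_cast natCast_zmod_ne_zero three_pos (by omega : 3 < 2 * N + 1)
  exact Q.norm_vertex_sub_lt_one (fun h => h1 (by linear_combination h))
    (fun h => h3 (by linear_combination -h))

theorem cos_angle_lt (Q : ReuleauxPolygon N) {i j : ZMod (2 * N + 1)}
    (h : Q.β i - Q.α i < Q.β j - Q.α j) :
    Real.cos (Q.β j - Q.α j) < Real.cos (Q.β i - Q.α i) :=
  Real.cos_lt_cos_of_nonneg_of_le_pi (by linarith [Q.α_lt_β i])
    (by linarith [Q.isUnitStar.lt_add_pi j]) h

/-! ### Configurations that are not rigid -/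

/-- Two consecutive vertices inside the outer circle can be moved in both directions. -/
theorem not_isRigid_of_consecutive (Q : ReuleauxPolygon N) (hr : HasCentredIncircle Q.body r)
    (hN : 2 ≤ N) {k : ZMod (2 * N + 1)} (hk : ‖Q.vertex k‖ ≠ 1 - r)
    (hk1 : ‖Q.vertex (k + 1)‖ ≠ 1 - r) : ¬ Q.IsRigid r := by
  obtain ⟨y, hy0, hy⟩ := Q.exists_linkage k
  have hlt : ‖y 0 - Q.vertex (k - 1)‖ < 1 := by
    rw [hy0]; exact Q.norm_vertex_succ_sub_pred_lt hN k
  have hx1 : ∀ᶠ ε in 𝓝 (0 : ℝ), ‖Q.movedVertex k ε‖ ≤ 1 - r :=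
    eventually_norm_le hy.continuousAt_left
      (by rw [movedVertex_zero]; exact lt_of_le_of_ne (Q.norm_vertex_le hr _) hk)
  have hy1 : ∀ᶠ ε in 𝓝 (0 : ℝ), ‖y ε‖ ≤ 1 - r :=
    eventually_norm_le hy.continuousAt_right
      (by rw [hy0]; exact lt_of_le_of_ne (Q.norm_vertex_le hr _) hk1)
  have h0 : (0 : ℂ) ∈ convexHull ℝ
      (Q.vertex '' {j | ‖Q.vertex j‖ = 1 - r ∧ j ≠ k ∧ j ≠ k + 1}) := by
    refine convexHull_mono (Set.image_mono ?_) (Q.zero_mem_convexHull hr)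
    exact fun j hj => ⟨hj, fun h => hk (h ▸ hj), fun h => hk1 (h ▸ hj)⟩
  -- Both directions are admissible, so the sign of the gap is free to choose the one that decreases
  -- the area.
  rcases le_total (IsLinkage.angleGap (Q.vertex (k - 1)) (Q.vertex (k + 2)) (Q.movedVertex k) y 0) 0
    with hg | hg
  · exact Q.not_isRigid hr hN hy0 hy (nhdsWithin_le_nhds (s := Set.Ioi 0))
      (hx1.filter_mono nhdsWithin_le_nhds) (hy1.filter_mono nhdsWithin_le_nhds)
      (hy.eventually_crossSum_lt_right hg hlt) h0
  · exact Q.not_isRigid hr hN hy0 hy (nhdsWithin_le_nhds (s := Set.Iio 0))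
      (hx1.filter_mono nhdsWithin_le_nhds) (hy1.filter_mono nhdsWithin_le_nhds)
      (hy.eventually_crossSum_lt_left hg hlt) h0

/-- A vertex on the outer circle that is not needed for the incircle can be moved into the interior
together with its successor. -/
theorem not_isRigid_of_angle_lt_succ (Q : ReuleauxPolygon N) (hr : HasCentredIncircle Q.body r)
    (hN : 2 ≤ N) {k : ZMod (2 * N + 1)} (hk : ‖Q.vertex k‖ = 1 - r)
    (hk1 : ‖Q.vertex (k + 1)‖ ≠ 1 - r) (h2 : ‖Q.vertex (k + 2)‖ = 1 - r)
    (h4 : ‖Q.vertex (k - 2)‖ = 1 - r)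
    (hang : Q.β k - Q.α k < Q.β (k + 1) - Q.α (k + 1)) : ¬ Q.IsRigid r := by
  obtain ⟨y, hy0, hy⟩ := Q.exists_linkage k
  have hlt : ‖y 0 - Q.vertex (k - 1)‖ < 1 := by
    rw [hy0]; exact Q.norm_vertex_succ_sub_pred_lt hN k
  have hx1 := (hy.eventually_norm_left_lt
    (by rw [movedVertex_zero]; exact (Q.planeCross_succ_pos hr hk).2)).mono
    fun ε h => show ‖Q.movedVertex k ε‖ ≤ 1 - r by
      rw [movedVertex_zero, hk] at h; exact h.le
  have hy1 : ∀ᶠ ε in 𝓝 (0 : ℝ), ‖y ε‖ ≤ 1 - r :=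
    eventually_norm_le hy.continuousAt_right
      (by rw [hy0]; exact lt_of_le_of_ne (Q.norm_vertex_le hr _) hk1)
  have hg := Q.angleGap_eq hy0
  have := Q.cos_angle_lt hang
  -- Positive ε both pulls P k inwards and, the gap being negative, decreases the area.
  refine Q.not_isRigid hr hN hy0 hy (nhdsWithin_le_nhds (s := Set.Ioi 0)) hx1
    (hy1.filter_mono nhdsWithin_le_nhds) (hy.eventually_crossSum_lt_right (by linarith) hlt)
    (convexHull_mono (Set.image_mono ?_) (Q.zero_mem_convexHull_diff hr hN hk h2 h4))
  exact fun j hj => ⟨hj.1, hj.2, fun h => hk1 (h ▸ hj.1)⟩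

/-- A vertex on the outer circle that is not needed for the incircle can be moved into the interior
together with its predecessor. -/
theorem not_isRigid_of_angle_lt_pred (Q : ReuleauxPolygon N) (hr : HasCentredIncircle Q.body r)
    (hN : 2 ≤ N) {k : ZMod (2 * N + 1)} (hk : ‖Q.vertex (k + 1)‖ = 1 - r)
    (hk1 : ‖Q.vertex k‖ ≠ 1 - r) (h2 : ‖Q.vertex (k + 1 + 2)‖ = 1 - r)
    (h4 : ‖Q.vertex (k + 1 - 2)‖ = 1 - r)
    (hang : Q.β (k + 1) - Q.α (k + 1) < Q.β k - Q.α k) : ¬ Q.IsRigid r := by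
  obtain ⟨y, hy0, hy⟩ := Q.exists_linkage k
  have hlt : ‖y 0 - Q.vertex (k - 1)‖ < 1 := by
    rw [hy0]; exact Q.norm_vertex_succ_sub_pred_lt hN k
  have hx1 : ∀ᶠ ε in 𝓝 (0 : ℝ), ‖Q.movedVertex k ε‖ ≤ 1 - r :=
    eventually_norm_le hy.continuousAt_left
      (by rw [movedVertex_zero]; exact lt_of_le_of_ne (Q.norm_vertex_le hr _) hk1)
  have hy1 := (hy.eventually_norm_right_lt (by
    rw [hy0, show k + 2 = k + 1 + 1 by ring]; exact (Q.planeCross_succ_pos hr hk).1)).mono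
    fun ε h => show ‖y ε‖ ≤ 1 - r by rw [hy0, hk] at h; exact h.le
  have hg := Q.angleGap_eq hy0
  have := Q.cos_angle_lt hang
  refine Q.not_isRigid hr hN hy0 hy (nhdsWithin_le_nhds (s := Set.Iio 0))
    (hx1.filter_mono nhdsWithin_le_nhds) hy1 (hy.eventually_crossSum_lt_left (by linarith) hlt)
    (convexHull_mono (Set.image_mono ?_) (Q.zero_mem_convexHull_diff hr hN hk h2 h4))
  exact fun j hj => ⟨hj.1, fun h => hk1 (h ▸ hj.1), hj.2⟩

theorem not_isRigid_of_alternating (Q : ReuleauxPolygon N) (hr : HasCentredIncircle Q.body r)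
    (hN : 2 ≤ N) {k : ZMod (2 * N + 1)} (h1 : ‖Q.vertex (k + 1)‖ ≠ 1 - r)
    (h3 : ‖Q.vertex (k - 1)‖ ≠ 1 - r) : ¬ Q.IsRigid r := by
  intro hQ
  have hk : ‖Q.vertex k‖ = 1 - r := by
    by_contra h
    exact Q.not_isRigid_of_consecutive hr hN h h1 hQ
  have h2 : ‖Q.vertex (k + 2)‖ = 1 - r := by
    by_contra h
    rw [show k + 2 = k + 1 + 1 by ring] at h
    exact Q.not_isRigid_of_consecutive hr hN h1 h hQ
  have h4 : ‖Q.vertex (k - 2)‖ = 1 - r := by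
    by_contra h
    rw [show k - 1 = k - 2 + 1 by ring] at h3
    exact Q.not_isRigid_of_consecutive hr hN h h3 hQ
  rcases Q.angle_lt_or_angle_lt hr hk h1 h2 h3 h4 with h | h
  · exact Q.not_isRigid_of_angle_lt_succ hr hN hk h1 h2 h4 h hQ
  · obtain ⟨i, rfl⟩ : ∃ i, k = i + 1 := ⟨k - 1, by ring⟩
    rw [add_sub_cancel_right] at h3 h
    exact Q.not_isRigid_of_angle_lt_pred hr hN hk h3 h2 h4 h hQ

/-- All vertices of a Reuleaux triangle are on the outer circle. -/
theorem norm_vertex_of_triangle (Q : ReuleauxPolygon 1) (hr : HasCentredIncircle Q.body r)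
    (k : ZMod (2 * 1 + 1)) : ‖Q.vertex k‖ = 1 - r := by
  by_contra hk
  have hk' := lt_of_le_of_ne (Q.norm_vertex_le hr k) hk
  have adj : ∀ i j : ZMod 3, i ≠ j → i = j + 1 ∨ j = i + 1 := by decide
  have side : ∀ i j : ZMod (2 * 1 + 1), i ≠ j →
      ‖Q.vertex i‖ ^ 2 + ‖Q.vertex j‖ ^ 2 - 2 * planeDot (Q.vertex i) (Q.vertex j) = 1 := by
    intro i j hij
    have h1 : ‖Q.vertex i - Q.vertex j‖ = 1 := by
      rcases adj i j hij with h | h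
      · rw [h]; exact Q.norm_vertex_succ_sub j
      · rw [h, norm_sub_rev]; exact Q.norm_vertex_succ_sub i
    rw [← planeDot_self_of_norm h1, norm_sq_eq_planeDot, norm_sq_eq_planeDot]
    simp only [planeDot, Complex.sub_re, Complex.sub_im]; ring
  have h0 := Q.zero_mem_convexHull hr
  -- Surrounding the origin gives an outer P i at a nonobtuse angle from P k, seen from the origin,
  -- then an outer P j at angle at least π/2 from P i. The unit sides yield ‖P k‖² + R² ≥ 1 ≥ 2 R²
  -- with R = 1 - r, against ‖P k‖ < R.
  obtain ⟨_, ⟨i, hi, rfl⟩, hi'⟩ := exists_planeDot_nonpos h0 (-Q.vertex k)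
  obtain ⟨_, ⟨j, hj, rfl⟩, hj'⟩ := exists_planeDot_nonpos h0 (Q.vertex i)
  have hi1 : ‖Q.vertex i‖ = 1 - r := hi
  have hj1 : ‖Q.vertex j‖ = 1 - r := hj
  have hR : 0 < 1 - r := (norm_nonneg _).trans_lt hk'
  have hki : k ≠ i := fun h => hk (h ▸ hi1)
  have hij : i ≠ j := by
    intro h
    rw [← h, ← norm_sq_eq_planeDot, hi1] at hj'
    nlinarith
  have s1 := side k i hki
  have s2 := side i j hij
  rw [planeDot_neg_left] at hi'
  rw [hi1] at s1 s2
  rw [hj1] at s2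
  nlinarith [norm_nonneg (Q.vertex k)]

theorem two_le_of_exists_norm_ne (Q : ReuleauxPolygon N) (hr : HasCentredIncircle Q.body r)
    {k : ZMod (2 * N + 1)} (hk : ‖Q.vertex k‖ ≠ 1 - r) : 2 ≤ N := by
  by_contra hN
  rcases (by omega : N = 0 ∨ N = 1) with rfl | rfl
  · have h := Q.norm_vertex_succ_sub k
    rw [Subsingleton.elim (α := ZMod 1) (k + 1) k, sub_self, norm_zero] at h
    exact zero_ne_one h
  · exact hk (Q.norm_vertex_of_triangle hr k)

end ReuleauxPolygon

/-! ### Partition into clusters and extremal arcs -/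

theorem proposition3p4 {N : ℕ} {r : ℝ} (Q : ReuleauxPolygon N)
    (hr : HasCentredIncircle Q.body r) (hQ : Q.IsRigid r) :
    ∃ C E : Finset (ZMod (2 * N + 1)),
      (∀ k ∈ C, Q.IsCluster r k) ∧
      (∀ k ∈ E, Q.IsExtremalArc r k) ∧
      (C : Set (ZMod (2 * N + 1))).PairwiseDisjoint labelTriple ∧
      Disjoint E (C.biUnion labelTriple) ∧
      E ∪ C.biUnion labelTriple = Finset.univ := by
  classical
  have near : ∀ k, ‖Q.vertex k‖ ≠ 1 - r → ‖Q.vertex (k + 1)‖ = 1 - r ∧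
      ‖Q.vertex (k - 1)‖ = 1 - r ∧ ‖Q.vertex (k + 2)‖ = 1 - r ∧ ‖Q.vertex (k - 2)‖ = 1 - r := by
    intro k hk
    have hN := Q.two_le_of_exists_norm_ne hr hk
    refine ⟨?_, ?_, ?_, ?_⟩ <;> by_contra h
    · exact Q.not_isRigid_of_consecutive hr hN hk h hQ
    · exact Q.not_isRigid_of_consecutive hr hN h (by rwa [sub_add_cancel]) hQ
    · exact Q.not_isRigid_of_alternating hr hN (k := k + 1)
        (by rwa [add_assoc, one_add_one_eq_two]) (by rwa [add_sub_cancel_right]) hQ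
    · exact Q.not_isRigid_of_alternating hr hN (k := k - 1)
        (by rwa [sub_add_cancel]) (by rwa [sub_sub, one_add_one_eq_two]) hQ
  -- Clusters are labelled by the inner vertices. An arc outside all triples has its centre and both
  -- ends on the outer circle, hence is extremal; two triples that meet have middle labels at
  -- distance at most two, which `near` excludes.
  set C : Finset (ZMod (2 * N + 1)) := Finset.univ.filter fun k => ‖Q.vertex k‖ ≠ 1 - r with hC
  have hCmem : ∀ k, k ∈ C ↔ ‖Q.vertex k‖ ≠ 1 - r := fun k => by simp [hC]
  refine ⟨C, (C.biUnion labelTriple)ᶜ, ?_, ?_, ?_, disjoint_compl_left, ?_⟩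
  · intro k hk
    rw [hCmem] at hk
    obtain ⟨h1, h2, h3, h4⟩ := near k hk
    exact ⟨Q.isTangentArc hr h2, Q.isTangentArc hr h1, Q.lt_norm_vertex hr k,
      lt_of_le_of_ne (Q.norm_vertex_le hr k) hk, h4, h3⟩
  · intro k hk
    simp only [Finset.mem_compl, Finset.mem_biUnion, hCmem, labelTriple, Finset.mem_insert,
      Finset.mem_singleton, not_exists, not_and, not_or] at hk
    refine ⟨Q.isTangentArc hr ?_, ?_, ?_⟩ <;> by_contra h
    · exact (hk k h).2.1 rfl
    · exact (hk (k + 1) h).1 (by ring)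
    · exact (hk (k - 1) h).2.2 (by ring)
  · intro i hi j hj hij
    rw [Finset.mem_coe, hCmem] at hi hj
    obtain ⟨h1, h2, h3, h4⟩ := near i hi
    rw [Function.onFun, Finset.disjoint_left]
    intro m hmi hmj
    simp only [labelTriple, Finset.mem_insert, Finset.mem_singleton] at hmi hmj
    have hcases : j = i ∨ j = i + 1 ∨ j = i - 1 ∨ j = i + 2 ∨ j = i - 2 := by
      rcases hmi with rfl | rfl | rfl <;> rcases hmj with h | h | h
      · left; linear_combination -h
      · right; right; left; linear_combination -h
      · right; right; right; right; linear_combination -h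
      · right; left; linear_combination -h
      · left; linear_combination -h
      · right; right; left; linear_combination -h
      · right; right; right; left; linear_combination -h
      · right; left; linear_combination -h
      · left; linear_combination -h
    rcases hcases with rfl | rfl | rfl | rfl | rfl
    · exact hij rfl
    · exact hj h1
    · exact hj h2
    · exact hj h3
    · exact hj h4
  · rw [Finset.union_comm, Finset.union_compl]
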